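/- Let $M_{2,4}\subset\mathbb C^6$ be the set of all vectors $\bigl((p_i^1-p_j^1)^2+(p_i^2-p_j^2)^2\bigr)_{1\le i<j\le 4}$ with $p_1,\dots,p_4\in\mathbb C^2$ (complex squared lengths, without conjugation), and let $$L_{2,4}=\{(l_{ij})_{1\le i<j\le 4}\in\mathbb C^6 : (l_{ij}^2)_{1\le i<j\le 4}\in M_{2,4}\},$$ an affine algebraic variety. A point $x\in L_{2,4}$ is singular if the dimension of the Zariski tangent space of $L_{2,4}$ at $x$ (the common kernel of the differentials at $x$ of all polynomials vanishing on $L_{2,4}$) is different from the local dimension of $L_{2,4}$ at $x$ (the largest dimension of an irreducible component of $L_{2,4}$ containing $x$); the set of these points is $\operatorname{Sing}(L_{2,4})$. The singular locus $\operatorname{Sing}(L_{2,4})$ is the union of $60$ distinct $3$-dimensional linear subspaces of $\mathbb C^6$. These $60$ subspaces are contained in $L_{2,4}$, and they are the only $3$-dimensional linear subspaces of $\mathbb C^6$ contained in $L_{2,4}$. Moreover, $L_{2,4}$ contains no linear subspace of dimension $4$ or more. -/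

import Mathlib

open MvPolynomial

noncomputable section

/-! ### Affine varieties in `ℂ^σ`: local dimension, tangent space, singular points -/

/-- The local dimension of a variety `V` at a point `x`: the largest dimension of an irreducible
component of `V` that contains `x`. The irreducible components of `V` are the zero loci of the
minimal primes `P` over the ideal `I(V)`; such a component contains `x` if and only if `P` is
contained in the ideal of `x`, and its dimension is the Krull dimension of `ℂ[σ] ⧸ P`. -/
def localDim {σ : Type*} (V : Set (σ → ℂ)) (x : σ → ℂ) : WithBot ℕ∞ :=
  ⨆ P ∈ {P : Ideal (MvPolynomial σ ℂ) |
      P ∈ (vanishingIdeal ℂ V).minimalPrimes ∧ P ≤ vanishingIdeal ℂ {x}},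
    ringKrullDim (MvPolynomial σ ℂ ⧸ P)

/-- The Zariski tangent space of `V` at `x`: the common kernel of the differentials at `x` of all
polynomials in `I(V)` (equivalently, of those in any generating set of `I(V)`). -/
def zariskiTangentSpace {σ : Type*} [Fintype σ] (V : Set (σ → ℂ)) (x : σ → ℂ) :
    Submodule ℂ (σ → ℂ) where
  carrier := {v | ∀ f ∈ vanishingIdeal ℂ V, ∑ i, eval x (pderiv i f) * v i = 0}
  zero_mem' := by
    intro f _
    simp
  add_mem' := by
    intro v w hv hw f hf
    simp only [Pi.add_apply, mul_add, Finset.sum_add_distrib]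
    rw [hv f hf, hw f hf, add_zero]
  smul_mem' := by
    intro c v hv f hf
    have h : ∑ i, eval x (pderiv i f) * (c • v) i
        = c * ∑ i, eval x (pderiv i f) * v i := by
      rw [Finset.mul_sum]
      refine Finset.sum_congr rfl fun i _ => ?_
      simp only [Pi.smul_apply, smul_eq_mul]
      ring
    rw [h, hv f hf, mul_zero]

/-- A point of `V` is smooth if the dimension of the Zariski tangent space is the local
dimension; the singular locus consists of the points of `V` that are not smooth. -/
def singularLocus {σ : Type*} [Fintype σ] (V : Set (σ → ℂ)) : Set (σ → ℂ) :=
  {x | x ∈ V ∧ (Module.finrank ℂ (zariskiTangentSpace V x) : WithBot ℕ∞) ≠ localDim V x}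

/-! ### The squared and the unsquared measurement varieties -/

/-- The edges `ij`, `i < j`, of the complete graph on `n` vertices. -/
abbrev Edge (n : ℕ) : Type := {e : Fin n × Fin n // e.1 < e.2}

/-- The complex squared lengths (no conjugation) of all the edges of a configuration `p` of `n`
points in `ℂ^d`. -/
def squaredLengths {d n : ℕ} (p : Fin n → Fin d → ℂ) : Edge n → ℂ :=
  fun e => ∑ k, (p e.1.1 k - p e.1.2 k) ^ 2

/-- The squared measurement variety `M_{d,n}`. -/
def squaredMeasurementVariety (d n : ℕ) : Set (Edge n → ℂ) :=
  Set.range (squaredLengths (d := d) (n := n))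

/-- The unsquared measurement variety `L_{d,n}`: the preimage of `M_{d,n}` under the map that
squares each coordinate. -/
def measurementVariety (d n : ℕ) : Set (Edge n → ℂ) :=
  {l | (fun e => l e ^ 2) ∈ squaredMeasurementVariety d n}

end

/-! ### Singular points of hypersurfaces -/

section Hypersurface

/-! A symmetric matrix of size three over `ℂ` is the Gram matrix of three vectors of `ℂ²` exactly
when its determinant vanishes, so `L_{2,4}` is the hypersurface of the Cayley–Menger sextic `F` in
the six lengths (`measurementVariety_two_four`). `F` is squarefree, hence generates the ideal of the
variety, and the singular points are the zeros of `F` and its gradient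
(`singularLocus_hypersurface`).

Each partial derivative is, up to a constant, a length times a cofactor `stress`. Where `F = 0` the
cofactors form a symmetric matrix of rank at most one with zero row sums. If all cofactors vanish,
the Gram matrix has rank at most one and the points are collinear: up to signs of the lengths these
are 32 subspaces. If some cofactor is nonzero, its edge is zero, and the rank one relations give a
triangle of zero edges (4 subspaces) or a zero edge whose two triangles have equal squared sides (24
subspaces). This is `isCritical_iff_exists_mem`.

Let `W` be a subspace of dimension at least three in `L_{2,4}`. The six lengths on `W` are linear
forms that satisfy `F = 0` identically and do not all lie in the span of two forms (`IsFrame`). The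
key claim `IsFrame.isCritical` says that the gradient of `F` then vanishes on `W` too. So `W` is
covered by the sixty subspaces, hence lies in one of them, which settles dimension three and
excludes larger dimensions.

The claim uses unique factorization. By Heron's formula each triangle has four linear factors. If
one of them is zero, `F` is `-2` times the square of Stewart's relation, which is solved directly.
Otherwise, for any two triangles the product of all eight factors is a square
(`IsFrame.exists_prod_mul_prod_eq_sq`), so every factor is proportional to another one. A triangle
with pairwise non-proportional factors forces opposite edges to have equal squares, and `F` then
splits into Pythagorean relations of rank two. If every triangle has a proportional pair, every
triangle has a zero edge or proportional edges, and again all forms lie in the span of two. -/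

lemma withBot_enat_add_one_inj {x y : WithBot ℕ∞} (h : x + 1 = y + 1) : x = y := by
  induction x with
  | bot =>
    induction y with
    | bot => rfl
    | coe b => exact absurd h (WithBot.bot_ne_coe (a := b + 1))
  | coe a =>
    induction y with
    | bot => simp at h
    | coe b =>
      have h' : a + 1 = b + 1 := by exact_mod_cast h
      rw [ENat.add_left_injective_of_ne_top ENat.one_ne_top h']

variable {σ : Type*}

/-- The automorphism of `ℂ[σ]` that translates by a vector. -/
noncomputable def translateEquiv (v : σ → ℂ) : MvPolynomial σ ℂ ≃ₐ[ℂ] MvPolynomial σ ℂ :=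
  AlgEquiv.ofAlgHom (aeval fun i => X i + C (v i)) (aeval fun i => X i - C (v i))
    (by ext i; simp [algebraMap_eq]) (by ext i; simp [algebraMap_eq])

lemma aeval_translateEquiv (v x : σ → ℂ) (p : MvPolynomial σ ℂ) :
    aeval x (translateEquiv v p) = aeval (x + v) p := by
  have : (aeval x : MvPolynomial σ ℂ →ₐ[ℂ] ℂ).comp (translateEquiv v).toAlgHom
      = aeval (x + v) := by
    ext i
    simp [translateEquiv]
  exact DFunLike.congr_fun this p

lemma height_vanishingIdeal_singleton_eq (x y : σ → ℂ) :
    (vanishingIdeal ℂ {x} : Ideal (MvPolynomial σ ℂ)).height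
      = (vanishingIdeal ℂ {y} : Ideal (MvPolynomial σ ℂ)).height := by
  have h : (vanishingIdeal ℂ {x} : Ideal (MvPolynomial σ ℂ))
      = (vanishingIdeal ℂ {y} : Ideal (MvPolynomial σ ℂ)).comap
          (translateEquiv (x - y)).toRingEquiv := by
    ext p
    rw [Ideal.mem_comap, mem_vanishingIdeal_singleton_iff, mem_vanishingIdeal_singleton_iff]
    have := aeval_translateEquiv (x - y) y p
    rw [add_sub_cancel] at this
    rw [← this]
    rfl
  rw [h]
  exact RingEquiv.height_comap _ _

variable [Fintype σ]

/-- By the Nullstellensatz every maximal ideal belongs to a point, and translations make all their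
heights equal, so each of them attains the supremum, which is the Krull dimension of the polynomial
ring. -/
lemma height_vanishingIdeal_singleton (x : σ → ℂ) :
    ((vanishingIdeal ℂ {x} : Ideal (MvPolynomial σ ℂ)).height : WithBot ℕ∞)
      = Fintype.card σ := by
  have h1 := Ideal.sup_isMaximal_height_eq_ringKrullDim (R := MvPolynomial σ ℂ)
  rw [MvPolynomial.ringKrullDim_of_isNoetherianRing, ringKrullDim_eq_zero_of_field, zero_add,
    Nat.card_eq_fintype_card] at h1
  rw [← h1, WithBot.coe_inj]
  apply le_antisymm
  · exact le_iSup₂_of_le (vanishingIdeal ℂ {x}) inferInstance le_rfl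
  · refine iSup₂_le fun I hI => ?_
    obtain ⟨y, rfl⟩ := isMaximal_iff_eq_vanishingIdeal_singleton.mp hI
    exact (height_vanishingIdeal_singleton_eq y x).le

lemma ringKrullDim_quotient_span_singleton {q : MvPolynomial σ ℂ} (hq : q ≠ 0)
    (hu : ¬ IsUnit q) :
    ringKrullDim (MvPolynomial σ ℂ ⧸ Ideal.span {q}) + 1 = Fintype.card σ := by
  apply le_antisymm
  · have := ringKrullDim_quotient_succ_le_of_nonZeroDivisor (mem_nonZeroDivisors_of_ne_zero hq)
    rwa [MvPolynomial.ringKrullDim_of_isNoetherianRing, ringKrullDim_eq_zero_of_field, zero_add,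
      Nat.card_eq_fintype_card] at this
  · obtain ⟨M, hM, hqM⟩ := exists_max_ideal_of_mem_nonunits hu
    obtain ⟨y, rfl⟩ := isMaximal_iff_eq_vanishingIdeal_singleton.mp hM
    rw [← height_vanishingIdeal_singleton y]
    exact Ideal.height_le_ringKrullDim_quotient_add_one hqM

lemma vanishingIdeal_setOf_eval_eq_zero {F : MvPolynomial σ ℂ} (hF : Squarefree F) :
    vanishingIdeal ℂ {x : σ → ℂ | eval x F = 0} = Ideal.span {F} := by
  have h : {x : σ → ℂ | eval x F = 0} = zeroLocus ℂ (Ideal.span {F}) := by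
    rw [zeroLocus_span]
    ext x
    simp [aeval_eq_eval]
  rw [h, vanishingIdeal_zeroLocus_eq_radical]
  exact ((isRadical_iff_span_singleton).mp hF.isRadical).radical

/-- By unique factorization a minimal prime over `F` contains an irreducible factor of `F`, and
minimality makes it the ideal generated by that factor. -/
lemma ringKrullDim_of_mem_minimalPrimes_span_singleton {F : MvPolynomial σ ℂ} (hF : F ≠ 0)
    {P : Ideal (MvPolynomial σ ℂ)} (hP : P ∈ (Ideal.span {F}).minimalPrimes) :
    ringKrullDim (MvPolynomial σ ℂ ⧸ P) + 1 = Fintype.card σ := by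
  have hPp : P.IsPrime := hP.1.1
  have hFP : F ∈ P := hP.1.2 (Ideal.mem_span_singleton_self F)
  obtain ⟨s, hs, u, hu⟩ := WfDvdMonoid.exists_factors F hF
  obtain ⟨q, hqs, hqP⟩ : ∃ q ∈ s, q ∈ P := by
    rw [← hu] at hFP
    rcases hPp.mem_or_mem hFP with h | h
    · exact (hPp.multiset_prod_mem_iff_exists_mem s).mp h
    · exact absurd (Ideal.eq_top_of_isUnit_mem _ h u.isUnit) hPp.ne_top
  have hq := hs q hqs
  have hqF : q ∣ F := (Multiset.dvd_prod hqs).trans ⟨u, hu.symm⟩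
  have hqp : (Ideal.span {q}).IsPrime :=
    (Ideal.span_singleton_prime hq.ne_zero).mpr hq.prime
  have hPq : P = Ideal.span {q} := by
    have hle : Ideal.span {q} ≤ P := (Ideal.span_singleton_le_iff_mem _).mpr hqP
    exact le_antisymm
      (hP.2 ⟨hqp, (Ideal.span_singleton_le_span_singleton).mpr hqF⟩ hle) hle
  rw [hPq]
  exact ringKrullDim_quotient_span_singleton hq.ne_zero hq.not_isUnit

lemma localDim_hypersurface_add_one {F : MvPolynomial σ ℂ} (hF : Squarefree F) {x : σ → ℂ}
    (hx : eval x F = 0) :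
    localDim {x : σ → ℂ | eval x F = 0} x + 1 = Fintype.card σ := by
  have hle : Ideal.span {F} ≤ vanishingIdeal ℂ {x} := by
    rw [Ideal.span_singleton_le_iff_mem, mem_vanishingIdeal_singleton_iff]
    simpa [aeval_eq_eval] using hx
  obtain ⟨P, hP, hPx⟩ := Ideal.exists_minimalPrimes_le hle
  have key : localDim {x : σ → ℂ | eval x F = 0} x = ringKrullDim (MvPolynomial σ ℂ ⧸ P) := by
    unfold localDim
    rw [vanishingIdeal_setOf_eval_eq_zero hF]
    apply le_antisymm
    · refine iSup₂_le fun Q hQ => ?_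
      have h1 := ringKrullDim_of_mem_minimalPrimes_span_singleton hF.ne_zero hQ.1
      have h2 := ringKrullDim_of_mem_minimalPrimes_span_singleton hF.ne_zero hP
      exact (withBot_enat_add_one_inj (h1.trans h2.symm)).le
    · exact le_iSup₂_of_le P ⟨hP, hPx⟩ le_rfl
  rw [key]
  exact ringKrullDim_of_mem_minimalPrimes_span_singleton hF.ne_zero hP

lemma mem_zariskiTangentSpace_hypersurface {F : MvPolynomial σ ℂ} (hF : Squarefree F)
    {x : σ → ℂ} (hx : eval x F = 0) (v : σ → ℂ) :
    v ∈ zariskiTangentSpace {x : σ → ℂ | eval x F = 0} x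
      ↔ ∑ i, eval x (pderiv i F) * v i = 0 := by
  change (∀ f ∈ vanishingIdeal ℂ {x : σ → ℂ | eval x F = 0}, _) ↔ _
  rw [vanishingIdeal_setOf_eval_eq_zero hF]
  refine ⟨fun h => h F (Ideal.mem_span_singleton_self F), fun h f hf => ?_⟩
  obtain ⟨g, rfl⟩ := Ideal.mem_span_singleton.mp hf
  have : ∀ i, eval x (pderiv i (F * g)) * v i = eval x g * (eval x (pderiv i F) * v i) := by
    intro i
    simp only [Derivation.leibniz, smul_eq_mul, map_add, map_mul, hx]
    ring
  rw [Finset.sum_congr rfl fun i _ => this i, ← Finset.mul_sum, h, mul_zero]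

/-- The tangent space is the kernel of the gradient, of dimension `n` or `n - 1` according to
whether the gradient is zero or not, while the local dimension is `n - 1` at every point. -/
lemma singularLocus_hypersurface {F : MvPolynomial σ ℂ} (hF : Squarefree F) :
    singularLocus {x : σ → ℂ | eval x F = 0}
      = {x | eval x F = 0 ∧ ∀ i, eval x (pderiv i F) = 0} := by
  classical
  ext x
  refine and_congr_right fun hx => ?_
  have hd := localDim_hypersurface_add_one hF hx
  set φ : (σ → ℂ) →ₗ[ℂ] ℂ := Fintype.linearCombination ℂ fun i => eval x (pderiv i F) with hφ
  have hT : zariskiTangentSpace {x : σ → ℂ | eval x F = 0} x = LinearMap.ker φ := by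
    ext v
    rw [mem_zariskiTangentSpace_hypersurface hF hx, LinearMap.mem_ker, hφ,
      Fintype.linearCombination_apply]
    simp only [smul_eq_mul, mul_comm]
  have hrn := LinearMap.finrank_range_add_finrank_ker φ
  rw [Module.finrank_fintype_fun_eq_card] at hrn
  rw [hT]
  constructor
  · intro h i
    by_contra hi
    apply h
    have hs : LinearMap.range φ = ⊤ := by
      refine LinearMap.range_eq_top.mpr (LinearMap.surjective fun h0 => hi ?_)
      have := DFunLike.congr_fun h0 (Pi.single i 1)
      simpa [hφ, Fintype.linearCombination_apply, Pi.single_apply] using this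
    rw [hs, finrank_top, Module.finrank_self, add_comm] at hrn
    rw [← hrn] at hd
    push_cast at hd
    exact (withBot_enat_add_one_inj hd).symm
  · intro h h'
    have h0 : φ = 0 := by
      ext i
      simp [hφ, h i]
    rw [h0, LinearMap.range_zero, finrank_bot, zero_add] at hrn
    rw [h0, hrn] at h'
    rw [← h'] at hd
    norm_cast at hd
    omega

end Hypersurface

/-! ### The measurement variety `L_{2,4}` as a hypersurface -/

/-- The Cayley–Menger determinant of four points as a function of the six edge lengths
`l₀₁, l₀₂, l₁₂, l₀₃, l₁₃, l₂₃`, written as a Gram determinant. -/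
def cayleyMenger {R : Type*} [CommRing R] (a b c d e f : R) : R :=
  2 * a ^ 2 * (2 * b ^ 2 * (2 * d ^ 2) - (b ^ 2 + d ^ 2 - f ^ 2) ^ 2)
    - (a ^ 2 + b ^ 2 - c ^ 2) * ((a ^ 2 + b ^ 2 - c ^ 2) * (2 * d ^ 2)
      - (b ^ 2 + d ^ 2 - f ^ 2) * (a ^ 2 + d ^ 2 - e ^ 2))
    + (a ^ 2 + d ^ 2 - e ^ 2) * ((a ^ 2 + b ^ 2 - c ^ 2) * (b ^ 2 + d ^ 2 - f ^ 2)
      - 2 * b ^ 2 * (a ^ 2 + d ^ 2 - e ^ 2))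

lemma map_cayleyMenger {R S : Type*} [CommRing R] [CommRing S] (φ : R →+* S) (a b c d e f : R) :
    φ (cayleyMenger a b c d e f)
      = cayleyMenger (φ a) (φ b) (φ c) (φ d) (φ e) (φ f) := by
  simp only [cayleyMenger, map_add, map_sub, map_mul, map_pow, map_ofNat]

abbrev e01 : Edge 4 := ⟨(0, 1), by decide⟩
abbrev e02 : Edge 4 := ⟨(0, 2), by decide⟩
abbrev e12 : Edge 4 := ⟨(1, 2), by decide⟩
abbrev e03 : Edge 4 := ⟨(0, 3), by decide⟩
abbrev e13 : Edge 4 := ⟨(1, 3), by decide⟩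
abbrev e23 : Edge 4 := ⟨(2, 3), by decide⟩

lemma forall_edge {P : Edge 4 → Prop} :
    (∀ e, P e) ↔ P e01 ∧ P e02 ∧ P e12 ∧ P e03 ∧ P e13 ∧ P e23 := by
  refine ⟨fun h => ⟨h _, h _, h _, h _, h _, h _⟩, ?_⟩
  rintro ⟨h1, h2, h3, h4, h5, h6⟩ ⟨⟨i, j⟩, h⟩
  fin_cases i <;> fin_cases j <;> first | exact absurd h (by decide) | assumption

/-- The polynomial that defines `L_{2,4}`. -/
noncomputable def cayleyMengerPoly : MvPolynomial (Edge 4) ℂ :=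
  cayleyMenger (X e01) (X e02) (X e12) (X e03) (X e13) (X e23)

lemma eval_cayleyMengerPoly (l : Edge 4 → ℂ) :
    eval l cayleyMengerPoly
      = cayleyMenger (l e01) (l e02) (l e12) (l e03) (l e13) (l e23) := by
  simp [cayleyMengerPoly, map_cayleyMenger (eval l)]

lemma totalDegree_cayleyMengerPoly_le : cayleyMengerPoly.totalDegree ≤ 6 := by
  have hX : ∀ i : Edge 4, ((X i : MvPolynomial (Edge 4) ℂ) ^ 2).IsHomogeneous 2 :=
    fun i => isHomogeneous_X_pow i 2
  have h2 : ∀ i : Edge 4, (2 * (X i : MvPolynomial (Edge 4) ℂ) ^ 2).IsHomogeneous 2 := by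
    intro i
    have h := (isHomogeneous_C (Edge 4) (2 : ℂ)).mul (hX i)
    rwa [zero_add, map_ofNat] at h
  have hg : ∀ i j k : Edge 4,
      ((X i : MvPolynomial (Edge 4) ℂ) ^ 2 + X j ^ 2 - X k ^ 2).IsHomogeneous 2 :=
    fun i j k => ((hX i).add (hX j)).sub (hX k)
  refine IsHomogeneous.totalDegree_le (n := 6) ?_
  unfold cayleyMengerPoly cayleyMenger
  refine IsHomogeneous.add (IsHomogeneous.sub ?_ ?_) ?_
  · exact (h2 _).mul (((h2 _).mul (h2 _)).sub ((hg _ _ _).pow 2))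
  · exact (hg _ _ _).mul (((hg _ _ _).mul (h2 _)).sub ((hg _ _ _).mul (hg _ _ _)))
  · exact (hg _ _ _).mul (((hg _ _ _).mul (hg _ _ _)).sub ((h2 _).mul (hg _ _ _)))

/-! ### Squarefreeness of the Cayley–Menger polynomial -/

section Squarefree

open Polynomial in
/-- The restriction of the Cayley–Menger determinant to a line of lengths of disphenoids. -/
noncomputable def disphenoidSextic : ℂ[X] :=
  -128 * Polynomial.X ^ 6 + 128 * Polynomial.X ^ 5 + 96 * Polynomial.X ^ 4 - 40 * Polynomial.X ^ 2 - 24 * Polynomial.X - 4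

open Polynomial in
lemma natDegree_disphenoidSextic : disphenoidSextic.natDegree = 6 := by
  unfold disphenoidSextic
  compute_degree!

open Polynomial in
lemma squarefree_disphenoidSextic : Squarefree disphenoidSextic := by
  have hd : derivative disphenoidSextic
      = -768 * Polynomial.X ^ 5 + 640 * Polynomial.X ^ 4 + 384 * Polynomial.X ^ 3 - 80 * Polynomial.X - 24 := by
    simp [disphenoidSextic]
    ring_nf
    simp only [map_ofNat]
    ring
  refine Separable.squarefree ?_
  -- Bézout coefficients for the sextic and its derivative, cleared of denominators by 360.
  refine ⟨Polynomial.C (1 / 360) * (6684 + 2576 * Polynomial.X - 8096 * Polynomial.X ^ 2 - 83648 * Polynomial.X ^ 3 + 71808 * Polynomial.X ^ 4),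
    Polynomial.C (1 / 360) * (-1129 - 3350 * Polynomial.X - 1200 * Polynomial.X ^ 2 + 3680 * Polynomial.X ^ 3 + 15936 * Polynomial.X ^ 4
      - 11968 * Polynomial.X ^ 5), ?_⟩
  have h1 : (Polynomial.C (1 / 360 : ℂ)) * 360 = 1 := by
    rw [← Polynomial.C_ofNat, ← Polynomial.C_mul]; norm_num
  rw [hd, disphenoidSextic]
  linear_combination h1

-- If `G * G * K` is the sextic form, its restriction to a line is squarefree, so `G` restricts to a
-- unit. The restriction still has degree 6, so `K` alone accounts for the full degree and `G` is
-- constant.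
open Polynomial in
lemma squarefree_cayleyMengerPoly : Squarefree cayleyMengerPoly := by
  -- Opposite edges get equal lengths `X`, `X + 1`, `2 X`. For such lengths the determinant is `4
  -- (a² + b² - c²) (a² - b² + c²) (-a² + b² + c²)`.
  let p : Edge 4 → ℂ[X] := fun e =>
    if e = e01 ∨ e = e23 then Polynomial.X
    else if e = e02 ∨ e = e13 then Polynomial.X + 1 else 2 * Polynomial.X
  have hp : ∀ e, (p e).natDegree ≤ 1 := by
    intro e
    simp only [p]
    split_ifs <;> compute_degree
  have hφ : MvPolynomial.aeval p cayleyMengerPoly = disphenoidSextic := by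
    rw [cayleyMengerPoly, ← AlgHom.coe_toRingHom, map_cayleyMenger]
    simp only [AlgHom.coe_toRingHom, MvPolynomial.aeval_X]
    have h1 : p e01 = Polynomial.X := rfl
    have h2 : p e02 = Polynomial.X + 1 := rfl
    have h3 : p e12 = 2 * Polynomial.X := rfl
    have h4 : p e03 = 2 * Polynomial.X := rfl
    have h5 : p e13 = Polynomial.X + 1 := rfl
    have h6 : p e23 = Polynomial.X := rfl
    rw [h1, h2, h3, h4, h5, h6, cayleyMenger, disphenoidSextic]
    ring
  have hS : disphenoidSextic ≠ 0 := squarefree_disphenoidSextic.ne_zero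
  have hF : cayleyMengerPoly ≠ 0 := by
    intro h
    rw [h, map_zero] at hφ
    exact hS hφ.symm
  rintro G ⟨K, hK⟩
  have hGK : disphenoidSextic
      = MvPolynomial.aeval p G * MvPolynomial.aeval p G * MvPolynomial.aeval p K := by
    rw [← hφ, hK, map_mul, map_mul]
  have hG0 : G ≠ 0 := by rintro rfl; simp at hK; exact hF hK
  have hK0 : K ≠ 0 := by rintro rfl; simp at hK; exact hF hK
  have hu : IsUnit (MvPolynomial.aeval p G) :=
    squarefree_disphenoidSextic _ (Dvd.intro _ hGK.symm)
  have hd := natDegree_disphenoidSextic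
  have hpG := hu.ne_zero
  have hpK : MvPolynomial.aeval p K ≠ 0 := by
    intro h
    rw [h, mul_zero] at hGK
    exact hS hGK
  rw [hGK, Polynomial.natDegree_mul (mul_ne_zero hpG hpG) hpK, Polynomial.natDegree_mul hpG hpG,
    Polynomial.natDegree_eq_zero_of_isUnit hu] at hd
  have hKd := MvPolynomial.aeval_natDegree_le K le_rfl p hp
  have ht := totalDegree_cayleyMengerPoly_le
  rw [hK, MvPolynomial.totalDegree_mul_of_isDomain (mul_ne_zero hG0 hG0) hK0,
    MvPolynomial.totalDegree_mul_of_isDomain hG0 hG0] at ht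
  have hGd : G.totalDegree = 0 := by omega
  rw [MvPolynomial.totalDegree_eq_zero_iff_eq_C] at hGd
  rw [hGd] at hG0 ⊢
  exact (IsUnit.mk0 _ (by simpa using hG0)).map MvPolynomial.C

end Squarefree

/-! ### Singular Gram matrices are realized by planar points -/

section Realization

/-- Two vectors of `ℂ²` with a prescribed Gram matrix. -/
lemma exists_gram_two (A B C : ℂ) :
    ∃ x y u v : ℂ, x ^ 2 + y ^ 2 = A ∧ u ^ 2 + v ^ 2 = C ∧ x * u + y * v = B := by
  by_cases hA : A = 0
  · by_cases hC : C = 0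
    -- Both vectors must be isotropic: multiples of `(1, i)` and `(1, -i)`, whose product is 2.
    · refine ⟨B / 2, B / 2 * Complex.I, 1, -Complex.I, ?_, ?_, ?_⟩
      · linear_combination (B / 2) ^ 2 * Complex.I_sq - hA
      · linear_combination Complex.I_sq - hC
      · linear_combination -(B / 2) * Complex.I_sq
    · obtain ⟨s, hs⟩ := IsAlgClosed.exists_pow_nat_eq (C) two_pos
      obtain ⟨t, ht⟩ := IsAlgClosed.exists_pow_nat_eq ((A - B ^ 2 / C)) two_pos
      have hs0 : s ≠ 0 := by rintro rfl; exact hC (by simpa using hs.symm)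
      refine ⟨B / s, t, s, 0, ?_, ?_, ?_⟩
      · rw [ht, ← hs]; field_simp; ring
      · rw [← hs]; ring
      · field_simp; ring
  · obtain ⟨s, hs⟩ := IsAlgClosed.exists_pow_nat_eq (A) two_pos
    obtain ⟨t, ht⟩ := IsAlgClosed.exists_pow_nat_eq ((C - B ^ 2 / A)) two_pos
    have hs0 : s ≠ 0 := by rintro rfl; exact hA (by simpa using hs.symm)
    refine ⟨s, 0, B / s, t, ?_, ?_, ?_⟩
    · rw [← hs]; ring
    · rw [ht, ← hs]; field_simp; ring
    · field_simp; ring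

/-- A symmetric `3 × 3` matrix with a kernel vector whose last entry is nonzero is the Gram
matrix of three vectors of `ℂ²`. -/
lemma exists_gram_three_of_ne_zero {A B D P Q R u v w : ℂ} (hw : w ≠ 0)
    (h1 : A * u + P * v + Q * w = 0) (h2 : P * u + B * v + R * w = 0)
    (h3 : Q * u + R * v + D * w = 0) :
    ∃ p q r : Fin 2 → ℂ, p 0 ^ 2 + p 1 ^ 2 = A ∧ q 0 ^ 2 + q 1 ^ 2 = B ∧ r 0 ^ 2 + r 1 ^ 2 = D ∧
      p 0 * q 0 + p 1 * q 1 = P ∧ p 0 * r 0 + p 1 * r 1 = Q ∧ q 0 * r 0 + q 1 * r 1 = R := by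
  obtain ⟨x, y, z, t, hA, hB, hP⟩ := exists_gram_two A P B
  refine ⟨![x, y], ![z, t], ![-(u * x + v * z) / w, -(u * y + v * t) / w],
    by simpa using hA, by simpa using hB, ?_, by simpa using hP, ?_, ?_⟩
  · simp only [Matrix.cons_val_zero, Matrix.cons_val_one]
    field_simp
    linear_combination u ^ 2 * hA + v ^ 2 * hB + 2 * u * v * hP + u * h1 + v * h2 - w * h3
  · simp only [Matrix.cons_val_zero, Matrix.cons_val_one]
    field_simp
    linear_combination -u * hA - v * hP - h1
  · simp only [Matrix.cons_val_zero, Matrix.cons_val_one]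
    field_simp
    linear_combination -v * hB - u * hP - h2

/-- A singular symmetric `3 × 3` matrix is the Gram matrix of three vectors of `ℂ²`. -/
lemma exists_gram_three {A B D P Q R : ℂ}
    (h : (!![A, P, Q; P, B, R; Q, R, D] : Matrix (Fin 3) (Fin 3) ℂ).det = 0) :
    ∃ p q r : Fin 2 → ℂ, p 0 ^ 2 + p 1 ^ 2 = A ∧ q 0 ^ 2 + q 1 ^ 2 = B ∧ r 0 ^ 2 + r 1 ^ 2 = D ∧
      p 0 * q 0 + p 1 * q 1 = P ∧ p 0 * r 0 + p 1 * r 1 = Q ∧ q 0 * r 0 + q 1 * r 1 = R := by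
  obtain ⟨x, hx, hMx⟩ := Matrix.exists_mulVec_eq_zero_iff.mpr h
  have h1 : A * x 0 + P * x 1 + Q * x 2 = 0 := by
    simpa [Matrix.mulVec, dotProduct, Fin.sum_univ_three] using congrFun hMx 0
  have h2 : P * x 0 + B * x 1 + R * x 2 = 0 := by
    simpa [Matrix.mulVec, dotProduct, Fin.sum_univ_three] using congrFun hMx 1
  have h3 : Q * x 0 + R * x 1 + D * x 2 = 0 := by
    simpa [Matrix.mulVec, dotProduct, Fin.sum_univ_three] using congrFun hMx 2
  -- The three vectors are permuted so that a nonzero coordinate of the kernel vector comes last;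
  -- the last vector is then a combination of the other two.
  by_cases hx2 : x 2 = 0
  · by_cases hx1 : x 1 = 0
    · have hx0 : x 0 ≠ 0 := by
        intro hx0
        apply hx
        ext i
        fin_cases i <;> simp [hx0, hx1, hx2]
      obtain ⟨p, q, r, k1, k2, k3, k4, k5, k6⟩ :=
        exists_gram_three_of_ne_zero (A := D) (B := B) (D := A) (P := R) (Q := Q) (R := P)
          (u := x 2) (v := x 1) (w := x 0) hx0 (by linear_combination h3)
          (by linear_combination h2) (by linear_combination h1)
      exact ⟨r, q, p, k3, k2, k1, by linear_combination k6, by linear_combination k5,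
        by linear_combination k4⟩
    · obtain ⟨p, q, r, k1, k2, k3, k4, k5, k6⟩ :=
        exists_gram_three_of_ne_zero (A := A) (B := D) (D := B) (P := Q) (Q := P) (R := R)
          (u := x 0) (v := x 2) (w := x 1) hx1 (by linear_combination h1)
          (by linear_combination h3) (by linear_combination h2)
      exact ⟨p, r, q, k1, k3, k2, k5, k4, by linear_combination k6⟩
  · exact exists_gram_three_of_ne_zero hx2 h1 h2 h3

lemma measurementVariety_two_four :
    measurementVariety 2 4 = {l | eval l cayleyMengerPoly = 0} := by
  ext l
  rw [Set.mem_ofPred_eq, eval_cayleyMengerPoly]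
  constructor
  · rintro ⟨p, hp⟩
    have h := forall_edge.mp (congrFun hp)
    simp only [squaredLengths, Fin.sum_univ_two] at h
    obtain ⟨h1, h2, h3, h4, h5, h6⟩ := h
    unfold cayleyMenger
    rw [← h1, ← h2, ← h3, ← h4, ← h5, ← h6]
    ring
  · intro h
    obtain ⟨p, q, r, k1, k2, k3, k4, k5, k6⟩ := exists_gram_three
      (A := l e01 ^ 2) (B := l e02 ^ 2) (D := l e03 ^ 2)
      (P := (l e01 ^ 2 + l e02 ^ 2 - l e12 ^ 2) / 2)
      (Q := (l e01 ^ 2 + l e03 ^ 2 - l e13 ^ 2) / 2)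
      (R := (l e02 ^ 2 + l e03 ^ 2 - l e23 ^ 2) / 2) (by
        rw [Matrix.det_fin_three]
        simp only [Matrix.of_apply, Matrix.cons_val', Matrix.cons_val_zero, Matrix.cons_val_one,
          Matrix.cons_val]
        unfold cayleyMenger at h
        linear_combination h / 8)
    refine ⟨![0, p, q, r], ?_⟩
    refine funext (forall_edge.mpr ?_)
    simp only [squaredLengths, Fin.sum_univ_two, Matrix.cons_val_zero, Matrix.cons_val_one,
      Matrix.cons_val, Pi.zero_apply]
    refine ⟨?_, ?_, ?_, ?_, ?_, ?_⟩
    · linear_combination k1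
    · linear_combination k2
    · linear_combination k1 + k2 - 2 * k4
    · linear_combination k3
    · linear_combination k1 + k3 - 2 * k5
    · linear_combination k2 + k3 - 2 * k6

end Realization

/-! ### The singular points of `L_{2,4}` -/

section Stress

variable {R : Type*} [CommRing R]

/-- The cofactor of the Gram matrix that belongs to the edge `01`; up to a factor, this is the
derivative of the Cayley–Menger determinant with respect to the squared length of that edge. -/
def stress (a b c d e f : R) : R :=
  -((2 * b ^ 2) * (2 * d ^ 2) - (b ^ 2 + d ^ 2 - f ^ 2) ^ 2
    + (a ^ 2 + d ^ 2 - e ^ 2) * (b ^ 2 + d ^ 2 - f ^ 2)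
    - (a ^ 2 + b ^ 2 - c ^ 2) * (2 * d ^ 2)
    + (a ^ 2 + b ^ 2 - c ^ 2) * (b ^ 2 + d ^ 2 - f ^ 2)
    - (a ^ 2 + d ^ 2 - e ^ 2) * (2 * b ^ 2))

/-- The gradient of the Cayley–Menger determinant vanishes at the given lengths. -/
structure IsCritical (a b c d e f : R) : Prop where
  h01 : a * stress a b c d e f = 0
  h02 : b * stress b a c d f e = 0
  h12 : c * stress c a b e f d = 0
  h03 : d * stress d b f a e c = 0
  h13 : e * stress e c f a d b = 0
  h23 : f * stress f b d c e a = 0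

lemma map_stress {S : Type*} [CommRing S] (φ : R →+* S) (a b c d e f : R) :
    φ (stress a b c d e f) = stress (φ a) (φ b) (φ c) (φ d) (φ e) (φ f) := by
  simp only [stress, map_add, map_sub, map_mul, map_pow, map_ofNat, map_neg]

/-- Used to evaluate an identity between linear forms on a subspace at each of its points. -/
lemma IsCritical.map {S : Type*} [CommRing S] (φ : R →+* S) {a b c d e f : R}
    (h : IsCritical a b c d e f) : IsCritical (φ a) (φ b) (φ c) (φ d) (φ e) (φ f) := by
  constructor
  · rw [← map_stress, ← map_mul, h.h01, map_zero]
  · rw [← map_stress, ← map_mul, h.h02, map_zero]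
  · rw [← map_stress, ← map_mul, h.h12, map_zero]
  · rw [← map_stress, ← map_mul, h.h03, map_zero]
  · rw [← map_stress, ← map_mul, h.h13, map_zero]
  · rw [← map_stress, ← map_mul, h.h23, map_zero]

/-- Euler's identity for a form of degree six. -/
lemma IsCritical.cayleyMenger_eq_zero {a b c d e f : ℂ} (h : IsCritical a b c d e f) :
    cayleyMenger a b c d e f = 0 := by
  obtain ⟨h1, h2, h3, h4, h5, h6⟩ := h
  unfold stress at *
  unfold cayleyMenger
  linear_combination (-2 / 3) * (a * h1 + b * h2 + c * h3 + d * h4 + e * h5 + f * h6)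

lemma derivation_cayleyMenger {A : Type*} [CommRing A] [Algebra R A] (D : Derivation R A A)
    (a b c d e f : A) :
    D (cayleyMenger a b c d e f) = -4 * (a * stress a b c d e f * D a
      + b * stress b a c d f e * D b + c * stress c a b e f d * D c
      + d * stress d b f a e c * D d + e * stress e c f a d b * D e
      + f * stress f b d c e a * D f) := by
  have h2 : D 2 = 0 := by simpa using D.map_natCast 2
  simp only [cayleyMenger, map_add, map_sub, Derivation.leibniz, Derivation.leibniz_pow,
    smul_eq_mul, nsmul_eq_mul, h2]
  unfold stress
  push_cast
  ring

/-- The three adjacent transpositions of the vertices generate the symmetric group, so each later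
argument is needed for one edge or one triangle only. -/
lemma IsCritical.swap01 {a b c d e f : R} (h : IsCritical a b c d e f) :
    IsCritical a c b e d f := by
  obtain ⟨h1, h2, h3, h4, h5, h6⟩ := h
  simp only [stress] at *
  constructor <;> simp only [stress]
  · linear_combination h1
  · linear_combination h3
  · linear_combination h2
  · linear_combination h5
  · linear_combination h4
  · linear_combination h6

lemma IsCritical.swap12 {a b c d e f : R} (h : IsCritical a b c d e f) :
    IsCritical b a c d f e := by
  obtain ⟨h1, h2, h3, h4, h5, h6⟩ := h
  simp only [stress] at *
  constructor <;> simp only [stress]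
  · linear_combination h2
  · linear_combination h1
  · linear_combination h3
  · linear_combination h4
  · linear_combination h6
  · linear_combination h5

lemma IsCritical.swap23 {a b c d e f : R} (h : IsCritical a b c d e f) :
    IsCritical a d e b c f := by
  obtain ⟨h1, h2, h3, h4, h5, h6⟩ := h
  simp only [stress] at *
  constructor <;> simp only [stress]
  · linear_combination h1
  · linear_combination h4
  · linear_combination h5
  · linear_combination h2
  · linear_combination h3
  · linear_combination h6

end Stress

lemma eval_pderiv_cayleyMengerPoly (l : Edge 4 → ℂ) (i : Edge 4) :
    eval l (pderiv i cayleyMengerPoly) = -4 * (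
      l e01 * stress (l e01) (l e02) (l e12) (l e03) (l e13) (l e23) * (Pi.single i 1 : Edge 4 → ℂ) e01
      + l e02 * stress (l e02) (l e01) (l e12) (l e03) (l e23) (l e13) * (Pi.single i 1 : Edge 4 → ℂ) e02
      + l e12 * stress (l e12) (l e01) (l e02) (l e13) (l e23) (l e03) * (Pi.single i 1 : Edge 4 → ℂ) e12
      + l e03 * stress (l e03) (l e02) (l e23) (l e01) (l e13) (l e12) * (Pi.single i 1 : Edge 4 → ℂ) e03
      + l e13 * stress (l e13) (l e12) (l e23) (l e01) (l e03) (l e02) * (Pi.single i 1 : Edge 4 → ℂ) e13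
      + l e23 * stress (l e23) (l e02) (l e03) (l e12) (l e13) (l e01) * (Pi.single i 1 : Edge 4 → ℂ) e23) := by
  have hs : ∀ j : Edge 4, eval l ((Pi.single i 1 : Edge 4 → MvPolynomial (Edge 4) ℂ) j)
      = (Pi.single i (1 : ℂ) : Edge 4 → ℂ) j := by
    intro j
    simp only [Pi.single_apply]
    split_ifs <;> simp
  rw [cayleyMengerPoly, derivation_cayleyMenger]
  simp only [map_mul, map_add, map_neg, map_ofNat, map_stress, eval_X, pderiv_X, hs]

lemma gradient_cayleyMengerPoly_eq_zero_iff (l : Edge 4 → ℂ) :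
    (∀ i, eval l (pderiv i cayleyMengerPoly) = 0)
      ↔ IsCritical (l e01) (l e02) (l e12) (l e03) (l e13) (l e23) := by
  simp only [forall_edge, eval_pderiv_cayleyMengerPoly]
  simp only [Pi.single_apply, Subtype.mk.injEq, Prod.mk.injEq]
  simp only [Fin.reduceEq, and_true, and_false, if_true, if_false, mul_zero, add_zero, zero_add,
    mul_one, mul_eq_zero (a := (-4 : ℂ)), and_self, neg_eq_zero, OfNat.ofNat_ne_zero, false_or]
  exact ⟨fun ⟨h1, h2, h3, h4, h5, h6⟩ => ⟨h1, h2, h3, h4, h5, h6⟩,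
    fun ⟨h1, h2, h3, h4, h5, h6⟩ => ⟨h1, h2, h3, h4, h5, h6⟩⟩

lemma singularLocus_measurementVariety_two_four :
    singularLocus (measurementVariety 2 4)
      = {l | IsCritical (l e01) (l e02) (l e12) (l e03) (l e13) (l e23)} := by
  rw [measurementVariety_two_four, singularLocus_hypersurface squarefree_cayleyMengerPoly]
  ext l
  rw [Set.mem_ofPred_eq, Set.mem_ofPred_eq, gradient_cayleyMengerPoly_eq_zero_iff,
    eval_cayleyMengerPoly]
  exact and_iff_right_of_imp IsCritical.cayleyMenger_eq_zero

/-! ### Critical points with a nonzero cofactor -/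

section CriticalPoints

/-- Four points on a line with the given squared distances. -/
def IsCollinear (a b c d e f : ℂ) : Prop :=
  ∃ x y z : ℂ, a ^ 2 = x ^ 2 ∧ b ^ 2 = y ^ 2 ∧ c ^ 2 = (x - y) ^ 2 ∧ d ^ 2 = z ^ 2 ∧
    e ^ 2 = (x - z) ^ 2 ∧ f ^ 2 = (y - z) ^ 2

/-- The cofactors are the off-diagonal entries `ω_ij` of a symmetric matrix with zero row sums, of
rank at most one when the determinant vanishes. The identities `i1` to `i4` are minors such as `ω₀₁
ω₀₂ = ω₀₀ ω₁₂`. They show that a second nonzero cofactor at the vertex 0 brings a third that closes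
a triangle, whose edges must all be zero. -/
lemma IsCritical.eq_or_of_stress_ne_zero {a b c d e f : ℂ} (hcr : IsCritical a b c d e f)
    (hne : stress a b c d e f ≠ 0) :
    (a = 0 ∧ b = 0 ∧ c = 0) ∨ (a = 0 ∧ d = 0 ∧ e = 0) ∨
      (a = 0 ∧ b ^ 2 = c ^ 2 ∧ d ^ 2 = e ^ 2) := by
  have h := hcr.cayleyMenger_eq_zero
  obtain ⟨h01, h02, h12, h03, h13, -⟩ := hcr
  have ha : a = 0 := (mul_eq_zero.mp h01).resolve_right hne
  have i1 : stress a b c d e f * stress b a c d f e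
      = -(stress a b c d e f + stress b a c d f e + stress d b f a e c) * stress c a b e f d := by
    unfold stress
    unfold cayleyMenger at h
    linear_combination (e ^ 2 + f ^ 2 - c ^ 2) * h
  have i2 : stress a b c d e f * stress d b f a e c
      = -(stress a b c d e f + stress b a c d f e + stress d b f a e c) * stress e c f a d b := by
    unfold stress
    unfold cayleyMenger at h
    linear_combination (c ^ 2 + f ^ 2 - e ^ 2) * h
  have i3 : stress a b c d e f * stress c a b e f d
      = -(stress a b c d e f + stress c a b e f d + stress e c f a d b) * stress b a c d f e := by
    unfold stress
    unfold cayleyMenger at h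
    linear_combination (d ^ 2 + f ^ 2 - b ^ 2) * h
  have i4 : stress a b c d e f * stress e c f a d b
      = -(stress a b c d e f + stress c a b e f d + stress e c f a d b) * stress d b f a e c := by
    unfold stress
    unfold cayleyMenger at h
    linear_combination (b ^ 2 + f ^ 2 - d ^ 2) * h
  by_cases k02 : stress b a c d f e = 0
  · by_cases k03 : stress d b f a e c = 0
    · have k12 : stress c a b e f d = 0 := by
        rw [k02, mul_zero] at i3
        exact (mul_eq_zero.mp i3).resolve_left hne
      have k13 : stress e c f a d b = 0 := by
        rw [k03, mul_zero] at i4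
        exact (mul_eq_zero.mp i4).resolve_left hne
      right; right
      refine ⟨ha, ?_, ?_⟩
      · have : (b ^ 2 - c ^ 2) * stress a b c d e f = 0 := by
          simp only [stress] at k12 k13 h01 ⊢
          linear_combination (b ^ 2 + c ^ 2 - a ^ 2) * k12
            + (c ^ 2 + d ^ 2 - a ^ 2 - f ^ 2) * k13 - a * h01
        exact sub_eq_zero.mp ((mul_eq_zero.mp this).resolve_right hne)
      · have : (d ^ 2 - e ^ 2) * stress a b c d e f = 0 := by
          simp only [stress] at k12 k13 h01 ⊢
          linear_combination (b ^ 2 + e ^ 2 - a ^ 2 - f ^ 2) * k12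
            + (d ^ 2 + e ^ 2 - a ^ 2) * k13 - a * h01
        exact sub_eq_zero.mp ((mul_eq_zero.mp this).resolve_right hne)
    · right; left
      refine ⟨ha, (mul_eq_zero.mp h03).resolve_right k03, ?_⟩
      refine (mul_eq_zero.mp h13).resolve_right fun k13 => ?_
      rw [k13, mul_zero] at i2
      exact mul_ne_zero hne k03 i2
  · left
    refine ⟨ha, (mul_eq_zero.mp h02).resolve_right k02, ?_⟩
    refine (mul_eq_zero.mp h12).resolve_right fun k12 => ?_
    rw [k12, mul_zero] at i1
    exact mul_ne_zero hne k02 i1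

end CriticalPoints

/-! ### Classification of the critical points -/

section CriticalClassification

/-- The principal minors of the Gram matrix are sums of cofactors, so the minors of size two needed
here vanish. Coordinates on the line are obtained by dividing a row by the root of its nonzero
diagonal entry. -/
lemma isCollinear_of_stress_eq_zero {a b c d e f : ℂ}
    (h01 : stress a b c d e f = 0) (h02 : stress b a c d f e = 0) (h12 : stress c a b e f d = 0)
    (h03 : stress d b f a e c = 0) (h13 : stress e c f a d b = 0) (h23 : stress f b d c e a = 0) :
    IsCollinear a b c d e f := by
  have k11 : (2 * b ^ 2) * (2 * d ^ 2) = (b ^ 2 + d ^ 2 - f ^ 2) ^ 2 := by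
    simp only [stress] at *
    linear_combination -h01 - h12 - h13
  have k22 : (2 * a ^ 2) * (2 * d ^ 2) = (a ^ 2 + d ^ 2 - e ^ 2) ^ 2 := by
    simp only [stress] at *
    linear_combination -h02 - h12 - h23
  have k33 : (2 * a ^ 2) * (2 * b ^ 2) = (a ^ 2 + b ^ 2 - c ^ 2) ^ 2 := by
    simp only [stress] at *
    linear_combination -h03 - h13 - h23
  have k23 : (2 * a ^ 2) * (b ^ 2 + d ^ 2 - f ^ 2)
      = (a ^ 2 + b ^ 2 - c ^ 2) * (a ^ 2 + d ^ 2 - e ^ 2) := by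
    simp only [stress] at *
    linear_combination -h23
  by_cases ha : a = 0
  · subst ha
    have hbc : b ^ 2 = c ^ 2 := by
      have h : (b ^ 2 - c ^ 2) ^ 2 = 0 := by linear_combination -k33
      exact sub_eq_zero.mp (pow_eq_zero_iff two_ne_zero |>.mp h)
    have hde : d ^ 2 = e ^ 2 := by
      have h : (d ^ 2 - e ^ 2) ^ 2 = 0 := by linear_combination -k22
      exact sub_eq_zero.mp (pow_eq_zero_iff two_ne_zero |>.mp h)
    by_cases hb : b = 0
    · subst hb
      have hdf : d ^ 2 = f ^ 2 := by
        have h : (d ^ 2 - f ^ 2) ^ 2 = 0 := by linear_combination -k11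
        exact sub_eq_zero.mp (pow_eq_zero_iff two_ne_zero |>.mp h)
      exact ⟨0, 0, d, rfl, rfl, by linear_combination -hbc, rfl, by linear_combination -hde,
        by linear_combination -hdf⟩
    · refine ⟨0, b, (b ^ 2 + d ^ 2 - f ^ 2) / (2 * b), rfl, rfl, by linear_combination -hbc,
        ?_, ?_, ?_⟩
      · field_simp; linear_combination k11
      · field_simp; linear_combination k11 - 4 * b ^ 2 * hde
      · field_simp; linear_combination k11
  · refine ⟨a, (a ^ 2 + b ^ 2 - c ^ 2) / (2 * a), (a ^ 2 + d ^ 2 - e ^ 2) / (2 * a), rfl,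
      ?_, ?_, ?_, ?_, ?_⟩
    · field_simp; linear_combination k33
    · field_simp; linear_combination k33
    · field_simp; linear_combination k22
    · field_simp; linear_combination k22
    · field_simp; linear_combination k22 + k33 - 2 * k23

/-- The union of the sixty subspaces, in terms of squared lengths. -/
def IsDegenerate (a b c d e f : ℂ) : Prop :=
  IsCollinear a b c d e f ∨
  ((a = 0 ∧ b = 0 ∧ c = 0) ∨ (a = 0 ∧ d = 0 ∧ e = 0) ∨ (b = 0 ∧ d = 0 ∧ f = 0) ∨
    (c = 0 ∧ e = 0 ∧ f = 0)) ∨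
  ((a = 0 ∧ b ^ 2 = c ^ 2 ∧ d ^ 2 = e ^ 2) ∨ (b = 0 ∧ a ^ 2 = c ^ 2 ∧ d ^ 2 = f ^ 2) ∨
    (c = 0 ∧ a ^ 2 = b ^ 2 ∧ e ^ 2 = f ^ 2) ∨ (d = 0 ∧ a ^ 2 = e ^ 2 ∧ b ^ 2 = f ^ 2) ∨
    (e = 0 ∧ a ^ 2 = d ^ 2 ∧ c ^ 2 = f ^ 2) ∨ (f = 0 ∧ b ^ 2 = d ^ 2 ∧ c ^ 2 = e ^ 2))

lemma IsCritical.isDegenerate {a b c d e f : ℂ} (h : IsCritical a b c d e f) :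
    IsDegenerate a b c d e f := by
  by_cases k0 : stress a b c d e f = 0
  swap
  · rcases h.eq_or_of_stress_ne_zero k0 with ⟨h1, h2, h3⟩ | ⟨h1, h2, h3⟩ | ⟨h1, h2, h3⟩
    · exact .inr (.inl (.inl ⟨h1, h2, h3⟩))
    · exact .inr (.inl (.inr (.inl ⟨h1, h2, h3⟩)))
    · exact .inr (.inr (.inl ⟨h1, h2, h3⟩))
  by_cases k1 : stress b a c d f e = 0
  swap
  · rcases h.swap12.eq_or_of_stress_ne_zero k1 with ⟨h1, h2, h3⟩ | ⟨h1, h2, h3⟩ | ⟨h1, h2, h3⟩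
    · exact .inr (.inl (.inl ⟨h2, h1, h3⟩))
    · exact .inr (.inl (.inr (.inr (.inl ⟨h1, h2, h3⟩))))
    · exact .inr (.inr (.inr (.inl ⟨h1, h2, h3⟩)))
  by_cases k2 : stress c a b e f d = 0
  swap
  · rcases h.swap01.swap12.eq_or_of_stress_ne_zero k2 with ⟨h1, h2, h3⟩ | ⟨h1, h2, h3⟩ | ⟨h1, h2, h3⟩
    · exact .inr (.inl (.inl ⟨h2, h3, h1⟩))
    · exact .inr (.inl (.inr (.inr (.inr ⟨h1, h2, h3⟩))))
    · exact .inr (.inr (.inr (.inr (.inl ⟨h1, h2, h3⟩))))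
  by_cases k3 : stress d b f a e c = 0
  swap
  · rcases h.swap12.swap23.swap12.eq_or_of_stress_ne_zero k3 with ⟨h1, h2, h3⟩ | ⟨h1, h2, h3⟩ | ⟨h1, h2, h3⟩
    · exact .inr (.inl (.inr (.inr (.inl ⟨h2, h1, h3⟩))))
    · exact .inr (.inl (.inr (.inl ⟨h2, h1, h3⟩)))
    · exact .inr (.inr (.inr (.inr (.inr (.inl ⟨h1, h3, h2⟩)))))
  by_cases k4 : stress e c f a d b = 0
  swap
  · rcases h.swap01.swap12.swap23.swap12.eq_or_of_stress_ne_zero k4 with ⟨h1, h2, h3⟩ | ⟨h1, h2, h3⟩ | ⟨h1, h2, h3⟩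
    · exact .inr (.inl (.inr (.inr (.inr ⟨h2, h1, h3⟩))))
    · exact .inr (.inl (.inr (.inl ⟨h2, h3, h1⟩)))
    · exact .inr (.inr (.inr (.inr (.inr (.inr (.inl ⟨h1, h3, h2⟩))))))
  by_cases k5 : stress f b d c e a = 0
  swap
  · rcases h.swap12.swap01.swap23.swap12.eq_or_of_stress_ne_zero k5 with ⟨h1, h2, h3⟩ | ⟨h1, h2, h3⟩ | ⟨h1, h2, h3⟩
    · exact .inr (.inl (.inr (.inr (.inl ⟨h2, h3, h1⟩))))
    · exact .inr (.inl (.inr (.inr (.inr ⟨h2, h3, h1⟩))))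
    · exact .inr (.inr (.inr (.inr (.inr (.inr (.inr (⟨h1, h2, h3⟩)))))))
  exact .inl (isCollinear_of_stress_eq_zero k0 k1 k2 k3 k4 k5)

end CriticalClassification

/-! ### The sixty subspaces: dimension and distinctness -/

section Subspaces

variable {R : Type*} [CommRing R]

lemma isCritical_of_collinear {a b c d e f x y z : R} (ha : a ^ 2 = x ^ 2) (hb : b ^ 2 = y ^ 2)
    (hc : c ^ 2 = (x - y) ^ 2) (hd : d ^ 2 = z ^ 2) (he : e ^ 2 = (x - z) ^ 2)
    (hf : f ^ 2 = (y - z) ^ 2) : IsCritical a b c d e f := by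
  constructor <;> simp only [stress, ha, hb, hc, hd, he, hf] <;> ring

lemma isCritical_of_triangle {a b c d e f : R} (ha : a = 0) (hb : b = 0) (hc : c = 0) :
    IsCritical a b c d e f := by
  subst ha hb hc
  constructor <;> simp only [stress] <;> ring

lemma isCritical_of_edge {a b c d e f : R} (ha : a = 0) (hb : b ^ 2 = c ^ 2)
    (hd : d ^ 2 = e ^ 2) : IsCritical a b c d e f := by
  subst ha
  constructor <;> simp only [stress, hb, hd] <;> ring

/-- A sign as an element of a ring. -/
def signOf (s : Bool) : R := if s then 1 else -1

lemma signOf_sq (s : Bool) : (signOf s : R) ^ 2 = 1 := by cases s <;> simp [signOf]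

/-- The labels of the sixty subspaces: the signs of a collinear configuration, a triangle of
zero edges, or a zero edge with two signs. -/
abbrev SubspaceIndex : Type :=
  (Bool × Bool × Bool × Bool × Bool) ⊕ Fin 4 ⊕ (Fin 6 × Bool × Bool)

/-- The three linear equations of the subspace with a given label. -/
def subspaceEquations (k : SubspaceIndex) (a b c d e f : R) : Fin 3 → R :=
  match k with
  | .inl (s, t, u, v, w) => ![c - signOf u * (a + signOf s * b), e - signOf v * (a + signOf t * d),
      f - signOf w * (b - signOf s * signOf t * d)]
  | .inr (.inl 0) => ![a, b, c]
  | .inr (.inl 1) => ![a, d, e]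
  | .inr (.inl 2) => ![b, d, f]
  | .inr (.inl 3) => ![c, e, f]
  | .inr (.inr (0, s, t)) => ![a, b - signOf s * c, d - signOf t * e]
  | .inr (.inr (1, s, t)) => ![b, a - signOf s * c, d - signOf t * f]
  | .inr (.inr (2, s, t)) => ![c, a - signOf s * b, e - signOf t * f]
  | .inr (.inr (3, s, t)) => ![d, a - signOf s * e, b - signOf t * f]
  | .inr (.inr (4, s, t)) => ![e, a - signOf s * d, c - signOf t * f]
  | .inr (.inr (5, s, t)) => ![f, b - signOf s * d, c - signOf t * e]

lemma map_subspaceEquations {S : Type*} [CommRing S] (φ : R →+* S) (k : SubspaceIndex)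
    (a b c d e f : R) (i : Fin 3) :
    φ (subspaceEquations k a b c d e f i)
      = subspaceEquations k (φ a) (φ b) (φ c) (φ d) (φ e) (φ f) i := by
  have hs : ∀ s, φ (signOf s) = signOf s := by intro s; cases s <;> simp [signOf]
  rcases k with ⟨s, t, u, v, w⟩ | j | ⟨j, s, t⟩ <;> (try fin_cases j) <;> fin_cases i <;>
    simp [subspaceEquations, hs]

lemma subspaceEquations_add (k : SubspaceIndex) (a b c d e f a' b' c' d' e' f' : R) :
    subspaceEquations k (a + a') (b + b') (c + c') (d + d') (e + e') (f + f')
      = subspaceEquations k a b c d e f + subspaceEquations k a' b' c' d' e' f' := by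
  rcases k with ⟨s, t, u, v, w⟩ | j | ⟨j, s, t⟩ <;> (try fin_cases j) <;> ext i <;>
    fin_cases i <;> simp [subspaceEquations] <;> ring

lemma subspaceEquations_smul (k : SubspaceIndex) (r a b c d e f : R) :
    subspaceEquations k (r * a) (r * b) (r * c) (r * d) (r * e) (r * f)
      = r • subspaceEquations k a b c d e f := by
  rcases k with ⟨s, t, u, v, w⟩ | j | ⟨j, s, t⟩ <;> (try fin_cases j) <;> ext i <;>
    fin_cases i <;> simp [subspaceEquations] <;> ring

/-- The three equations are independent, which gives codimension three. -/
lemma subspaceEquations_surjective (k : SubspaceIndex) (r : Fin 3 → R) :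
    ∃ a b c d e f, subspaceEquations k a b c d e f = r := by
  have hr : r = ![r 0, r 1, r 2] := by ext i; fin_cases i <;> rfl
  rw [hr]
  rcases k with ⟨s, t, u, v, w⟩ | j | ⟨j, s, t⟩ <;> (try fin_cases j)
  · exact ⟨0, 0, r 0, 0, r 1, r 2, by simp [subspaceEquations]⟩
  · exact ⟨r 0, r 1, r 2, 0, 0, 0, by simp [subspaceEquations]⟩
  · exact ⟨r 0, 0, 0, r 1, r 2, 0, by simp [subspaceEquations]⟩
  · exact ⟨0, r 0, 0, r 1, 0, r 2, by simp [subspaceEquations]⟩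
  · exact ⟨0, 0, r 0, 0, r 1, r 2, by simp [subspaceEquations]⟩
  · exact ⟨r 0, r 1, 0, r 2, 0, 0, by simp [subspaceEquations]⟩
  · exact ⟨r 1, r 0, 0, r 2, 0, 0, by simp [subspaceEquations]⟩
  · exact ⟨r 1, 0, r 0, 0, r 2, 0, by simp [subspaceEquations]⟩
  · exact ⟨r 1, r 2, 0, r 0, 0, 0, by simp [subspaceEquations]⟩
  · exact ⟨r 1, 0, r 2, 0, r 0, 0, by simp [subspaceEquations]⟩
  · exact ⟨0, r 1, r 2, 0, 0, r 0, by simp [subspaceEquations]⟩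

/-- A vector that lies in exactly one of the sixty subspaces. -/
def genericVector (k : SubspaceIndex) : ℤ × ℤ × ℤ × ℤ × ℤ × ℤ :=
  match k with
  | .inl (s, t, u, v, w) => (1, 3, signOf u * (1 + signOf s * 3), 10,
      signOf v * (1 + signOf t * 10), signOf w * (3 - signOf s * signOf t * 10))
  | .inr (.inl 0) => (0, 0, 0, 1, 2, 4)
  | .inr (.inl 1) => (0, 1, 2, 0, 0, 4)
  | .inr (.inl 2) => (1, 0, 2, 0, 4, 0)
  | .inr (.inl 3) => (1, 2, 0, 4, 0, 0)
  | .inr (.inr (0, s, t)) => (0, signOf s * 2, 2, signOf t * 5, 5, 1)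
  | .inr (.inr (1, s, t)) => (signOf s * 2, 0, 2, signOf t * 5, 1, 5)
  | .inr (.inr (2, s, t)) => (signOf s * 2, 2, 0, 1, signOf t * 5, 5)
  | .inr (.inr (3, s, t)) => (signOf s * 2, signOf t * 5, 1, 0, 2, 5)
  | .inr (.inr (4, s, t)) => (signOf s * 2, 1, signOf t * 5, 2, 0, 5)
  | .inr (.inr (5, s, t)) => (1, signOf s * 2, signOf t * 5, 2, 5, 0)

/-- Whether an integer vector lies in the subspace with a given label. -/
def satisfiesEquations (k : SubspaceIndex) (v : ℤ × ℤ × ℤ × ℤ × ℤ × ℤ) : Bool :=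
  decide (∀ i, subspaceEquations k v.1 v.2.1 v.2.2.1 v.2.2.2.1 v.2.2.2.2.1 v.2.2.2.2.2 i = 0)

-- The test vectors are integral, so that the distinctness of the sixty subspaces becomes a finite
-- decidable check.
set_option maxRecDepth 100000 in
lemma satisfiesEquations_genericVector :
    ∀ j k : SubspaceIndex, satisfiesEquations j (genericVector k) = decide (j = k) := by
  decide +kernel

/-- The vector of edge lengths with the given entries. -/
def ofEdges (a b c d e f : R) : Edge 4 → R := fun i =>
  if i = e01 then a else if i = e02 then b else if i = e12 then c else
    if i = e03 then d else if i = e13 then e else f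

/-- The sixty subspaces that make up the singular locus of `L_{2,4}`. -/
noncomputable def degenerateSubspace (k : SubspaceIndex) : Submodule ℂ (Edge 4 → ℂ) :=
  LinearMap.ker
    ({ toFun := fun l => subspaceEquations k (l e01) (l e02) (l e12) (l e03) (l e13) (l e23)
       map_add' := fun _ _ => subspaceEquations_add k _ _ _ _ _ _ _ _ _ _ _ _
       map_smul' := fun _ _ => subspaceEquations_smul k _ _ _ _ _ _ _ } :
      (Edge 4 → ℂ) →ₗ[ℂ] (Fin 3 → ℂ))

lemma mem_degenerateSubspace {k : SubspaceIndex} {l : Edge 4 → ℂ} :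
    l ∈ degenerateSubspace k
      ↔ subspaceEquations k (l e01) (l e02) (l e12) (l e03) (l e13) (l e23) = 0 := Iff.rfl

lemma finrank_degenerateSubspace (k : SubspaceIndex) :
    Module.finrank ℂ (degenerateSubspace k) = 3 := by
  have h := LinearMap.finrank_range_add_finrank_ker
    ({ toFun := fun l => subspaceEquations k (l e01) (l e02) (l e12) (l e03) (l e13) (l e23)
       map_add' := fun _ _ => subspaceEquations_add k _ _ _ _ _ _ _ _ _ _ _ _
       map_smul' := fun _ _ => subspaceEquations_smul k _ _ _ _ _ _ _ } :
      (Edge 4 → ℂ) →ₗ[ℂ] (Fin 3 → ℂ))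
  rw [LinearMap.range_eq_top.mpr, finrank_top, Module.finrank_fintype_fun_eq_card,
    Module.finrank_fintype_fun_eq_card, Fintype.card_fin, show Fintype.card (Edge 4) = 6 from rfl]
    at h
  · change 3 + Module.finrank ℂ (degenerateSubspace k) = 6 at h
    omega
  · intro r
    obtain ⟨a, b, c, d, e, f, h⟩ := subspaceEquations_surjective k r
    exact ⟨ofEdges a b c d e f, h⟩

lemma degenerateSubspace_injective : Function.Injective degenerateSubspace := by
  intro j k h
  have hcast : ∀ i : SubspaceIndex, (fun x => ((ofEdges (genericVector k).1
      (genericVector k).2.1 (genericVector k).2.2.1 (genericVector k).2.2.2.1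
      (genericVector k).2.2.2.2.1 (genericVector k).2.2.2.2.2 x : ℤ) : ℂ)) ∈ degenerateSubspace i
        ↔ i = k := by
    intro i
    have h := satisfiesEquations_genericVector i k
    rw [satisfiesEquations, decide_eq_decide] at h
    rw [mem_degenerateSubspace, ← h, funext_iff]
    refine forall_congr' fun r => ?_
    rw [← Int.cast_inj (α := ℂ), Int.cast_zero]
    exact iff_of_eq (congrArg (· = 0)
      (map_subspaceEquations (Int.castRingHom ℂ) i _ _ _ _ _ _ r).symm)
  exact (hcast j).mp (h ▸ (hcast k).mpr rfl)

end Subspaces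

/-! ### The critical points are the union of the sixty subspaces -/

section Union

lemma isCritical_of_mem_degenerateSubspace {k : SubspaceIndex} {l : Edge 4 → ℂ}
    (h : l ∈ degenerateSubspace k) :
    IsCritical (l e01) (l e02) (l e12) (l e03) (l e13) (l e23) := by
  rw [mem_degenerateSubspace] at h
  have h0 := congrFun h 0
  have h1 := congrFun h 1
  have h2 := congrFun h 2
  rcases k with ⟨s, t, u, v, w⟩ | j | ⟨j, s, t⟩
  · simp only [subspaceEquations, Matrix.cons_val, Pi.zero_apply] at h0 h1 h2
    have hs := signOf_sq (R := ℂ) s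
    have ht := signOf_sq (R := ℂ) t
    have hu := signOf_sq (R := ℂ) u
    have hv := signOf_sq (R := ℂ) v
    have hw := signOf_sq (R := ℂ) w
    refine isCritical_of_collinear (x := l e01) (y := -signOf s * l e02) (z := -signOf t * l e03)
      rfl ?_ ?_ ?_ ?_ ?_
    · linear_combination -l e02 ^ 2 * hs
    · rw [sub_eq_zero.mp h0]; linear_combination (l e01 + signOf s * l e02) ^ 2 * hu
    · linear_combination -l e03 ^ 2 * ht
    · rw [sub_eq_zero.mp h1]; linear_combination (l e01 + signOf t * l e03) ^ 2 * hv
    · rw [sub_eq_zero.mp h2]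
      linear_combination (l e02 - signOf s * signOf t * l e03) ^ 2 * hw
        + (signOf t ^ 2 * l e03 ^ 2 - l e02 ^ 2) * hs
  · fin_cases j
    all_goals simp only [subspaceEquations, Matrix.cons_val, Pi.zero_apply] at h0 h1 h2
    · exact isCritical_of_triangle h0 h1 h2
    · exact (isCritical_of_triangle h0 h1 h2).swap23
    · exact (isCritical_of_triangle h0 h1 h2).swap23.swap12
    · exact (isCritical_of_triangle h0 h1 h2).swap23.swap12.swap01
  · have hs := signOf_sq (R := ℂ) s
    have ht := signOf_sq (R := ℂ) t
    have sq : ∀ {x y r : ℂ}, r ^ 2 = 1 → x - r * y = 0 → x ^ 2 = y ^ 2 := by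
      intro x y r hr h
      rw [sub_eq_zero.mp h, mul_pow, hr, one_mul]
    fin_cases j
    all_goals simp only [subspaceEquations, Matrix.cons_val, Pi.zero_apply] at h0 h1 h2
    · exact isCritical_of_edge h0 (sq hs h1) (sq ht h2)
    · exact (isCritical_of_edge h0 (sq hs h1) (sq ht h2)).swap12
    · exact (isCritical_of_edge h0 (sq hs h1) (sq ht h2)).swap12.swap01
    · exact (isCritical_of_edge h0 (sq hs h1) (sq ht h2)).swap12.swap23
    · exact (isCritical_of_edge h0 (sq hs h1) (sq ht h2)).swap12.swap23.swap01
    · exact (isCritical_of_edge h0 (sq hs h1) (sq ht h2)).swap12.swap23.swap01.swap12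

lemma exists_sign {x y : ℂ} (h : x ^ 2 = y ^ 2) : ∃ s, x = signOf s * y := by
  rcases sq_eq_sq_iff_eq_or_eq_neg.mp h with h | h
  · exact ⟨true, by simp [signOf, h]⟩
  · exact ⟨false, by simp [signOf, h]⟩

lemma IsDegenerate.exists_mem {l : Edge 4 → ℂ}
    (h : IsDegenerate (l e01) (l e02) (l e12) (l e03) (l e13) (l e23)) :
    ∃ k, l ∈ degenerateSubspace k := by
  have vec : ∀ {x y z : ℂ}, x = 0 → y = 0 → z = 0 → ![x, y, z] = 0 := by
    rintro x y z rfl rfl rfl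
    ext i; fin_cases i <;> rfl
  have edge : ∀ {x y z u v : ℂ}, x = 0 → y ^ 2 = z ^ 2 → u ^ 2 = v ^ 2 →
      ∃ s t, ![x, y - signOf s * z, u - signOf t * v] = 0 := by
    intro x y z u v hx hy hu
    obtain ⟨s, hs⟩ := exists_sign hy
    obtain ⟨t, ht⟩ := exists_sign hu
    exact ⟨s, t, vec hx (sub_eq_zero.mpr hs) (sub_eq_zero.mpr ht)⟩
  rcases h with ⟨x, y, z, h1, h2, h3, h4, h5, h6⟩ | h | h
  -- Collinear coordinates matter only up to a common sign, which is normalized so that the first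
  -- one becomes `l e01`. Five signs remain, hence 32 subspaces.
  · obtain ⟨r, hr⟩ := exists_sign h1.symm
    have hrr := signOf_sq (R := ℂ) r
    obtain ⟨s, hs⟩ := exists_sign (x := -(signOf r * y)) (y := l e02)
      (by linear_combination y ^ 2 * hrr - h2)
    obtain ⟨t, ht⟩ := exists_sign (x := -(signOf r * z)) (y := l e03)
      (by linear_combination z ^ 2 * hrr - h4)
    have hss := signOf_sq (R := ℂ) s
    have hxr : l e01 = signOf r * x := by
      rw [hr]; linear_combination -l e01 * hrr
    obtain ⟨u, hu⟩ := exists_sign (x := l e12) (y := l e01 + signOf s * l e02) (by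
      rw [h3, ← hs, hxr]; linear_combination -(x - y) ^ 2 * hrr)
    obtain ⟨v, hv⟩ := exists_sign (x := l e13) (y := l e01 + signOf t * l e03) (by
      rw [h5, ← ht, hxr]; linear_combination -(x - z) ^ 2 * hrr)
    obtain ⟨w, hw⟩ := exists_sign (x := l e23) (y := l e02 - signOf s * signOf t * l e03) (by
      have h : l e02 - signOf s * signOf t * l e03 = signOf s * signOf r * (z - y) := by
        linear_combination -l e02 * hss - signOf s * hs + signOf s * ht
      rw [h6, h]; linear_combination -(y - z) ^ 2 * hrr - (y - z) ^ 2 * signOf r ^ 2 * hss)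
    exact ⟨.inl (s, t, u, v, w),
      vec (sub_eq_zero.mpr hu) (sub_eq_zero.mpr hv) (sub_eq_zero.mpr hw)⟩
  · rcases h with ⟨h1, h2, h3⟩ | ⟨h1, h2, h3⟩ | ⟨h1, h2, h3⟩ | ⟨h1, h2, h3⟩
    · exact ⟨.inr (.inl 0), vec h1 h2 h3⟩
    · exact ⟨.inr (.inl 1), vec h1 h2 h3⟩
    · exact ⟨.inr (.inl 2), vec h1 h2 h3⟩
    · exact ⟨.inr (.inl 3), vec h1 h2 h3⟩
  · rcases h with ⟨h1, h2, h3⟩ | ⟨h1, h2, h3⟩ | ⟨h1, h2, h3⟩ | ⟨h1, h2, h3⟩ | ⟨h1, h2, h3⟩ |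
      ⟨h1, h2, h3⟩
    · obtain ⟨s, t, h⟩ := edge h1 h2 h3
      exact ⟨.inr (.inr (0, s, t)), h⟩
    · obtain ⟨s, t, h⟩ := edge h1 h2 h3
      exact ⟨.inr (.inr (1, s, t)), h⟩
    · obtain ⟨s, t, h⟩ := edge h1 h2 h3
      exact ⟨.inr (.inr (2, s, t)), h⟩
    · obtain ⟨s, t, h⟩ := edge h1 h2 h3
      exact ⟨.inr (.inr (3, s, t)), h⟩
    · obtain ⟨s, t, h⟩ := edge h1 h2 h3
      exact ⟨.inr (.inr (4, s, t)), h⟩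
    · obtain ⟨s, t, h⟩ := edge h1 h2 h3
      exact ⟨.inr (.inr (5, s, t)), h⟩

lemma isCritical_iff_exists_mem {l : Edge 4 → ℂ} :
    IsCritical (l e01) (l e02) (l e12) (l e03) (l e13) (l e23) ↔ ∃ k, l ∈ degenerateSubspace k :=
  ⟨fun h => h.isDegenerate.exists_mem, fun ⟨_, h⟩ => isCritical_of_mem_degenerateSubspace h⟩

end Union

/-! ### Linear forms -/

section LinearForms

variable {σ : Type*}

lemma prime_of_isHomogeneous_one {p : MvPolynomial σ ℂ} (hp : p.IsHomogeneous 1) (h0 : p ≠ 0) :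
    Prime p := by
  refine (irreducible_of_totalDegree_eq_one (hp.totalDegree h0) fun x hx => ?_).prime
  refine IsUnit.mk0 x ?_
  rintro rfl
  exact h0 (MvPolynomial.ext _ _ fun i => by simpa using hx i)

/-- The polynomial `q` is a scalar multiple of `p`. -/
def IsMultiple (p q : MvPolynomial σ ℂ) : Prop := ∃ c : ℂ, q = C c * p

lemma isMultiple_of_dvd {p q : MvPolynomial σ ℂ} (hp : p.IsHomogeneous 1)
    (hq : q.IsHomogeneous 1) (h : p ∣ q) : IsMultiple p q := by
  by_cases h0 : q = 0
  · exact ⟨0, by simp [h0]⟩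
  · obtain ⟨r, rfl⟩ := h
    have hp0 := left_ne_zero_of_mul h0
    have hr0 := right_ne_zero_of_mul h0
    have h1 := hq.totalDegree h0
    rw [totalDegree_mul_of_isDomain hp0 hr0, hp.totalDegree hp0] at h1
    refine ⟨coeff 0 r, ?_⟩
    rw [← totalDegree_eq_zero_iff_eq_C.mp (by omega), mul_comm]

lemma IsMultiple.symm {p q : MvPolynomial σ ℂ} (h : IsMultiple p q) (hq : q ≠ 0) :
    IsMultiple q p := by
  obtain ⟨c, rfl⟩ := h
  have hc : c ≠ 0 := by rintro rfl; simp at hq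
  refine ⟨c⁻¹, ?_⟩
  rw [← mul_assoc, ← C_mul, inv_mul_cancel₀ hc, C_1, one_mul]

lemma IsMultiple.trans {p q r : MvPolynomial σ ℂ} (h : IsMultiple p q) (h' : IsMultiple q r) :
    IsMultiple p r := by
  obtain ⟨c, rfl⟩ := h
  obtain ⟨d, rfl⟩ := h'
  exact ⟨d * c, by rw [C_mul]; ring⟩

lemma IsMultiple.mem {p q : MvPolynomial σ ℂ} (h : IsMultiple p q)
    {N : Submodule ℂ (MvPolynomial σ ℂ)} (hp : p ∈ N) : q ∈ N := by
  obtain ⟨c, rfl⟩ := h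
  rw [← smul_eq_C_mul]
  exact N.smul_mem c hp

lemma C_mul_mem {p : MvPolynomial σ ℂ} {N : Submodule ℂ (MvPolynomial σ ℂ)} (c : ℂ)
    (hp : p ∈ N) : C c * p ∈ N := IsMultiple.mem ⟨c, rfl⟩ hp

lemma mem_of_C_mul_mem {p : MvPolynomial σ ℂ} {N : Submodule ℂ (MvPolynomial σ ℂ)} {c : ℂ}
    (hc : c ≠ 0) (hp : C c * p ∈ N) : p ∈ N := by
  have := C_mul_mem c⁻¹ hp
  rwa [← mul_assoc, ← C_mul, inv_mul_cancel₀ hc, C_1, one_mul] at this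

lemma mem_of_add_mem_of_sub_mem {p q : MvPolynomial σ ℂ} {N : Submodule ℂ (MvPolynomial σ ℂ)}
    (h1 : p + q ∈ N) (h2 : p - q ∈ N) : p ∈ N ∧ q ∈ N := by
  have h3 := C_mul_mem (1 / 2) (N.add_mem h1 h2)
  have h4 := C_mul_mem (1 / 2) (N.sub_mem h1 h2)
  have e : (C (1 / 2 : ℂ) : MvPolynomial σ ℂ) * 2 = 1 := by
    rw [← map_ofNat C 2, ← C_mul]; norm_num
  constructor
  · convert h3 using 1; linear_combination -p * e
  · convert h4 using 1; linear_combination -q * e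

/-- The form `p` is zero or prime. In the second case it divides `r` or `s`, is proportional to it
or that form is zero, and cancelling `p` makes `q` a multiple of the other form. This is the source
of nearly every contradiction with `IsFrame.spans`. -/
lemma exists_mem_span_pair_of_mul_eq_mul {p q r s : MvPolynomial σ ℂ} (hp : p.IsHomogeneous 1)
    (hr : r.IsHomogeneous 1) (hs : s.IsHomogeneous 1) (h : p * q = r * s) :
    ∃ u v, p ∈ Submodule.span ℂ {u, v} ∧ q ∈ Submodule.span ℂ {u, v} ∧
      r ∈ Submodule.span ℂ {u, v} ∧ s ∈ Submodule.span ℂ {u, v} := by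
  have left : ∀ u v : MvPolynomial σ ℂ, u ∈ Submodule.span ℂ {u, v} :=
    fun u v => Submodule.subset_span (by simp)
  have right : ∀ u v : MvPolynomial σ ℂ, v ∈ Submodule.span ℂ {u, v} :=
    fun u v => Submodule.subset_span (by simp)
  by_cases hp0 : p = 0
  · rw [hp0, zero_mul, eq_comm, mul_eq_zero] at h
    rw [hp0]
    rcases h with rfl | rfl
    · exact ⟨q, s, zero_mem _, left _ _, zero_mem _, right _ _⟩
    · exact ⟨q, r, zero_mem _, left _ _, right _ _, zero_mem _⟩
  · have key : ∀ r s : MvPolynomial σ ℂ, r.IsHomogeneous 1 → p * q = r * s → p ∣ r →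
        (r ∈ Submodule.span ℂ {p, s} ∧ q ∈ Submodule.span ℂ {p, s}) := by
      intro r s hr h hd
      obtain ⟨c, rfl⟩ := isMultiple_of_dvd hp hr hd
      refine ⟨C_mul_mem c (left _ _), ?_⟩
      have : q = C c * s := mul_left_cancel₀ hp0 (by linear_combination h)
      rw [this]
      exact C_mul_mem c (right _ _)
    rcases (prime_of_isHomogeneous_one hp hp0).dvd_or_dvd (Dvd.intro _ h) with hd | hd
    · obtain ⟨h1, h2⟩ := key r s hr h hd
      exact ⟨p, s, left _ _, h2, h1, right _ _⟩
    · obtain ⟨h1, h2⟩ := key s r hs (h.trans (mul_comm _ _)) hd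
      exact ⟨p, r, left _ _, h2, right _ _, h1⟩

/-- A prime occurs in a square with even multiplicity, so it divides a further one of the eight
factors. -/
lemma exists_isMultiple_of_prod_mul_prod_eq_sq {k k' : Fin 4 → MvPolynomial σ ℂ}
    {q : MvPolynomial σ ℂ} (hk : ∀ i, (k i).IsHomogeneous 1) (hk' : ∀ i, (k' i).IsHomogeneous 1)
    (h0 : ∀ i, k i ≠ 0) (h : (∏ i, k i) * ∏ i, k' i = q ^ 2) (i : Fin 4) :
    (∃ j, j ≠ i ∧ IsMultiple (k i) (k j)) ∨ ∃ j, IsMultiple (k i) (k' j) := by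
  classical
  have hp := prime_of_isHomogeneous_one (hk i) (h0 i)
  rw [← Finset.mul_prod_erase Finset.univ k (Finset.mem_univ i), mul_assoc] at h
  obtain ⟨r, rfl⟩ := hp.dvd_of_dvd_pow (Dvd.intro _ h)
  have h2 : (∏ j ∈ Finset.univ.erase i, k j) * ∏ j, k' j = k i * r ^ 2 :=
    mul_left_cancel₀ (h0 i) (by linear_combination h)
  rcases hp.dvd_or_dvd (Dvd.intro _ h2.symm) with hd | hd
  · obtain ⟨j, hj, hd⟩ := (Prime.dvd_finsetProd_iff hp _).mp hd
    exact .inl ⟨j, Finset.ne_of_mem_erase hj, isMultiple_of_dvd (hk i) (hk j) hd⟩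
  · obtain ⟨j, -, hd⟩ := (Prime.dvd_finsetProd_iff hp _).mp hd
    exact .inr ⟨j, isMultiple_of_dvd (hk i) (hk' j) hd⟩

end LinearForms

/-! ### Linear families of edge lengths -/

section Frames

variable {σ : Type*}

/-- Six linear forms on which the Cayley–Menger determinant vanishes identically and which are
not all in the span of two forms. -/
structure IsFrame (a b c d e f : MvPolynomial σ ℂ) : Prop where
  ha : a.IsHomogeneous 1
  hb : b.IsHomogeneous 1
  hc : c.IsHomogeneous 1
  hd : d.IsHomogeneous 1
  he : e.IsHomogeneous 1
  hf : f.IsHomogeneous 1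
  eq_zero : cayleyMenger a b c d e f = 0
  spans : ∀ u v : MvPolynomial σ ℂ, a ∈ Submodule.span ℂ {u, v} → b ∈ Submodule.span ℂ {u, v} →
    c ∈ Submodule.span ℂ {u, v} → d ∈ Submodule.span ℂ {u, v} → e ∈ Submodule.span ℂ {u, v} →
    f ∈ Submodule.span ℂ {u, v} → False

variable {a b c d e f : MvPolynomial σ ℂ}

lemma IsFrame.swap01 (h : IsFrame a b c d e f) : IsFrame a c b e d f where
  ha := h.ha
  hb := h.hc
  hc := h.hb
  hd := h.he
  he := h.hd
  hf := h.hf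
  eq_zero := by rw [← h.eq_zero]; simp only [cayleyMenger]; ring
  spans := fun u v h1 h2 h3 h4 h5 h6 => h.spans u v h1 h3 h2 h5 h4 h6

lemma IsFrame.swap12 (h : IsFrame a b c d e f) : IsFrame b a c d f e where
  ha := h.hb
  hb := h.ha
  hc := h.hc
  hd := h.hd
  he := h.hf
  hf := h.he
  eq_zero := by rw [← h.eq_zero]; simp only [cayleyMenger]; ring
  spans := fun u v h1 h2 h3 h4 h5 h6 => h.spans u v h2 h1 h3 h4 h6 h5

lemma IsFrame.swap23 (h : IsFrame a b c d e f) : IsFrame a d e b c f where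
  ha := h.ha
  hb := h.hd
  hc := h.he
  hd := h.hb
  he := h.hc
  hf := h.hf
  eq_zero := by rw [← h.eq_zero]; simp only [cayleyMenger]; ring
  spans := fun u v h1 h2 h3 h4 h5 h6 => h.spans u v h1 h4 h5 h2 h3 h6

/-- Signs in front of two edges of a triangle do not matter. -/
lemma IsFrame.neg_bc (h : IsFrame a b c d e f) : IsFrame a (-b) (-c) d e f where
  ha := h.ha
  hb := h.hb.neg
  hc := h.hc.neg
  hd := h.hd
  he := h.he
  hf := h.hf
  eq_zero := by rw [← h.eq_zero]; simp only [cayleyMenger]; ring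
  spans := fun u v h1 h2 h3 h4 h5 h6 =>
    h.spans u v h1 (by simpa using neg_mem h2) (by simpa using neg_mem h3) h4 h5 h6

lemma IsCritical.neg_bc (h : IsCritical a b c d e f) : IsCritical a (-b) (-c) d e f := by
  obtain ⟨h1, h2, h3, h4, h5, h6⟩ := h
  simp only [stress] at *
  constructor <;> simp only [stress]
  · linear_combination h1
  · linear_combination -h2
  · linear_combination -h3
  · linear_combination h4
  · linear_combination h5
  · linear_combination h6

lemma left_mem_span_pair (u v : MvPolynomial σ ℂ) : u ∈ Submodule.span ℂ {u, v} :=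
  Submodule.subset_span (by simp)

lemma right_mem_span_pair (u v : MvPolynomial σ ℂ) : v ∈ Submodule.span ℂ {u, v} :=
  Submodule.subset_span (by simp)

lemma isHomogeneous_C_mul {p : MvPolynomial σ ℂ} (hp : p.IsHomogeneous 1) (c : ℂ) :
    (C c * p).IsHomogeneous 1 := by
  simpa using (isHomogeneous_C σ c).mul hp

/-- The case of a zero triangle inequality with proportional edges. -/
lemma IsFrame.isCritical_of_proportional {κ : ℂ} (h : IsFrame a (C κ * a) c d e f)
    (hc : c = -(a + C κ * a)) (ha : a ≠ 0) : IsCritical a (C κ * a) c d e f := by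
  have h0 := h.eq_zero
  -- For `c = -(a + b)` the determinant is `-2` times the square of Stewart's relation `b e² + a f²
  -- = (a + b) (d² + a b)`, here with `b = κ a`.
  have hS : a * (C κ * (a ^ 2 + d ^ 2 - e ^ 2) + (C κ * a) ^ 2 + d ^ 2 - f ^ 2) = 0 := by
    refine pow_eq_zero_iff two_ne_zero |>.mp ?_
    have h2 : (-2 : MvPolynomial σ ℂ) ≠ 0 := by simp
    refine (mul_eq_zero.mp ?_).resolve_left h2
    rw [← h0, hc, cayleyMenger]
    ring
  have hQ := (mul_eq_zero.mp hS).resolve_left ha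
  by_cases hκ0 : κ = 0
  · subst hκ0
    simp only [C_0, zero_mul, add_zero] at hQ hc ⊢
    refine (isCritical_of_edge rfl ?_ ?_).swap12
    · rw [hc]; ring
    · linear_combination hQ
  by_cases hκ1 : 1 + κ = 0
  · have hκ : κ = -1 := by linear_combination hκ1
    subst hκ
    simp only [C_neg, C_1, neg_mul, one_mul, add_neg_cancel, neg_zero] at hQ hc ⊢
    refine (isCritical_of_edge hc ?_ ?_).swap12.swap01
    · ring
    · linear_combination hQ
  exfalso
  -- Stewart's relation reads `f² + κ e² = (1 + κ) (d² + κ a²)`; with roots of `κ` and `1 + κ` both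
  -- sides split into linear factors.
  obtain ⟨r, hr⟩ := IsAlgClosed.exists_pow_nat_eq κ two_pos
  obtain ⟨s, hs⟩ := IsAlgClosed.exists_pow_nat_eq (1 + κ) two_pos
  have hr0 : r ≠ 0 := by rintro rfl; exact hκ0 (by simpa using hr.symm)
  have hs0 : s ≠ 0 := by rintro rfl; exact hκ1 (by simpa using hs.symm)
  have hI : (C Complex.I : MvPolynomial σ ℂ) ^ 2 = -1 := by
    rw [← C_pow, Complex.I_sq, C_neg, C_1]
  have hrC : (C r : MvPolynomial σ ℂ) ^ 2 = C κ := by rw [← C_pow, hr]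
  have hsC : (C s : MvPolynomial σ ℂ) ^ 2 = 1 + C κ := by rw [← C_pow, hs, C_add, C_1]
  obtain ⟨u, v, h1, h2, h3, h4⟩ := exists_mem_span_pair_of_mul_eq_mul
    (p := f + C (Complex.I * r) * e) (q := f - C (Complex.I * r) * e)
    (r := C s * d + C (s * Complex.I * r) * a) (s := C s * d - C (s * Complex.I * r) * a)
    (h.hf.add (isHomogeneous_C_mul h.he _))
    ((isHomogeneous_C_mul h.hd _).add (isHomogeneous_C_mul h.ha _))
    ((isHomogeneous_C_mul h.hd _).sub (isHomogeneous_C_mul h.ha _)) (by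
      simp only [C_mul]
      linear_combination -hQ + (C s ^ 2 * C r ^ 2 * a ^ 2 - C r ^ 2 * e ^ 2) * hI
        + (e ^ 2 - C s ^ 2 * a ^ 2) * hrC - (d ^ 2 + C κ * a ^ 2) * hsC)
  obtain ⟨hf, he⟩ := mem_of_add_mem_of_sub_mem h1 h2
  obtain ⟨hd, ha'⟩ := mem_of_add_mem_of_sub_mem h3 h4
  replace he := mem_of_C_mul_mem (by simp [hr0]) he
  replace hd := mem_of_C_mul_mem hs0 hd
  replace ha' := mem_of_C_mul_mem (by simp [hr0, hs0]) ha'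
  have hb := C_mul_mem κ ha'
  refine h.spans u v ha' hb ?_ hd he hf
  rw [hc]
  exact neg_mem (add_mem ha' hb)

lemma exists_eq_of_dvd_sq_sub_sq (ha : a.IsHomogeneous 1) (hd : d.IsHomogeneous 1)
    (he : e.IsHomogeneous 1) (ha0 : a ≠ 0) (h : a ∣ a ^ 2 + d ^ 2 - e ^ 2) :
    ∃ ε μ : ℂ, ε ^ 2 = 1 ∧ e = C ε * d + C μ * a := by
  have h1 : a ∣ (e - d) * (e + d) := by
    obtain ⟨r, hr⟩ := h
    exact ⟨a - r, by linear_combination -hr⟩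
  rcases (prime_of_isHomogeneous_one ha ha0).dvd_or_dvd h1 with h1 | h1
  · obtain ⟨μ, hμ⟩ := isMultiple_of_dvd ha (he.sub hd) h1
    exact ⟨1, μ, by simp, by rw [C_1]; linear_combination hμ⟩
  · obtain ⟨μ, hμ⟩ := isMultiple_of_dvd ha (he.add hd) h1
    exact ⟨-1, μ, by simp, by rw [C_neg, C_1]; linear_combination hμ⟩

/-- The case of a zero triangle inequality with edges that are not proportional. -/
lemma IsFrame.isCritical_of_not_isMultiple (h : IsFrame a b c d e f) (hc : c = -(a + b))
    (ha : a ≠ 0) (hab : ¬ IsMultiple a b) : IsCritical a b c d e f := by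
  have hb : b ≠ 0 := by rintro rfl; exact hab ⟨0, by simp⟩
  have h0 := h.eq_zero
  have hS : b * (a ^ 2 + d ^ 2 - e ^ 2) + a * (b ^ 2 + d ^ 2 - f ^ 2) = 0 := by
    refine pow_eq_zero_iff two_ne_zero |>.mp ?_
    have h2 : (-2 : MvPolynomial σ ℂ) ≠ 0 := by simp
    refine (mul_eq_zero.mp ?_).resolve_left h2
    rw [← h0, hc, cayleyMenger]
    ring
  obtain ⟨ε, μ, hε, he⟩ := exists_eq_of_dvd_sq_sub_sq h.ha h.hd h.he ha (by
    have h1 : a ∣ b * (a ^ 2 + d ^ 2 - e ^ 2) :=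
      ⟨-(b ^ 2 + d ^ 2 - f ^ 2), by linear_combination hS⟩
    exact ((prime_of_isHomogeneous_one h.ha ha).dvd_or_dvd h1).resolve_left
      fun h2 => hab (isMultiple_of_dvd h.ha h.hb h2))
  obtain ⟨δ, ν, hδ, hf⟩ := exists_eq_of_dvd_sq_sub_sq h.hb h.hd h.hf hb (by
    have h1 : b ∣ a * (b ^ 2 + d ^ 2 - f ^ 2) :=
      ⟨-(a ^ 2 + d ^ 2 - e ^ 2), by linear_combination hS⟩
    exact ((prime_of_isHomogeneous_one h.hb hb).dvd_or_dvd h1).resolve_left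
      fun h2 => hab ((isMultiple_of_dvd h.hb h.ha h2).symm ha))
  have hεC : (C ε : MvPolynomial σ ℂ) ^ 2 = 1 := by rw [← C_pow, hε, C_1]
  have hδC : (C δ : MvPolynomial σ ℂ) ^ 2 = 1 := by rw [← C_pow, hδ, C_1]
  -- With `e = ε d + μ a` and `f = δ d + ν b`, Stewart's relation is `a b` times a linear relation.
  -- All six forms lie in the span of `a, b, d`, so these three are independent and each coefficient
  -- vanishes.
  have hL : C (1 - μ ^ 2) * a + C (1 - ν ^ 2) * b - C (2 * (ε * μ + δ * ν)) * d = 0 := by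
    refine (mul_eq_zero.mp ?_).resolve_left (mul_ne_zero ha hb)
    simp only [C_mul, C_sub, C_add, C_pow, C_1, map_ofNat]
    rw [he, hf] at hS
    linear_combination hS + b * d ^ 2 * hεC + a * d ^ 2 * hδC
  have hμ : 1 - μ ^ 2 = 0 := by
    by_contra hne
    have h1 : a ∈ Submodule.span ℂ {b, d} := mem_of_C_mul_mem hne (by
      rw [show C (1 - μ ^ 2) * a = C (2 * (ε * μ + δ * ν)) * d - C (1 - ν ^ 2) * b by
        linear_combination hL]
      exact sub_mem (C_mul_mem _ (right_mem_span_pair _ _)) (C_mul_mem _ (left_mem_span_pair _ _)))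
    refine h.spans b d h1 (left_mem_span_pair _ _) ?_ (right_mem_span_pair _ _) ?_ ?_
    · rw [hc]; exact neg_mem (add_mem h1 (left_mem_span_pair _ _))
    · rw [he]; exact add_mem (C_mul_mem _ (right_mem_span_pair _ _)) (C_mul_mem _ h1)
    · rw [hf]
      exact add_mem (C_mul_mem _ (right_mem_span_pair _ _)) (C_mul_mem _ (left_mem_span_pair _ _))
  have hν : 1 - ν ^ 2 = 0 := by
    by_contra hne
    have h1 : b ∈ Submodule.span ℂ {a, d} := mem_of_C_mul_mem hne (by
      rw [show C (1 - ν ^ 2) * b = C (2 * (ε * μ + δ * ν)) * d - C (1 - μ ^ 2) * a by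
        linear_combination hL]
      exact sub_mem (C_mul_mem _ (right_mem_span_pair _ _)) (C_mul_mem _ (left_mem_span_pair _ _)))
    refine h.spans a d (left_mem_span_pair _ _) h1 ?_ (right_mem_span_pair _ _) ?_ ?_
    · rw [hc]; exact neg_mem (add_mem (left_mem_span_pair _ _) h1)
    · rw [he]
      exact add_mem (C_mul_mem _ (right_mem_span_pair _ _)) (C_mul_mem _ (left_mem_span_pair _ _))
    · rw [hf]; exact add_mem (C_mul_mem _ (right_mem_span_pair _ _)) (C_mul_mem _ h1)
  have hεμ : 2 * (ε * μ + δ * ν) = 0 := by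
    by_contra hne
    have h1 : d ∈ Submodule.span ℂ {a, b} := mem_of_C_mul_mem hne (by
      rw [show C (2 * (ε * μ + δ * ν)) * d = C (1 - μ ^ 2) * a + C (1 - ν ^ 2) * b by
        linear_combination -hL]
      exact add_mem (C_mul_mem _ (left_mem_span_pair _ _)) (C_mul_mem _ (right_mem_span_pair _ _)))
    refine h.spans a b (left_mem_span_pair _ _) (right_mem_span_pair _ _) ?_ h1 ?_ ?_
    · rw [hc]; exact neg_mem (add_mem (left_mem_span_pair _ _) (right_mem_span_pair _ _))
    · rw [he]; exact add_mem (C_mul_mem _ h1) (C_mul_mem _ (left_mem_span_pair _ _))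
    · rw [hf]; exact add_mem (C_mul_mem _ h1) (C_mul_mem _ (right_mem_span_pair _ _))
  have hμC : (C μ : MvPolynomial σ ℂ) ^ 2 = 1 := by
    rw [← C_pow, ← C_1]; congr 1; linear_combination -hμ
  have hνC : (C ν : MvPolynomial σ ℂ) ^ 2 = 1 := by
    rw [← C_pow, ← C_1]; congr 1; linear_combination -hν
  have hC : (C ε * C μ + C δ * C ν : MvPolynomial σ ℂ) = 0 := by
    rw [← C_mul, ← C_mul, ← C_add, ← C_0]; congr 1; linear_combination hεμ / 2
  refine isCritical_of_collinear (x := a) (y := -b) (z := -(C ε * C μ * d)) rfl (by ring)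
    (by rw [hc]; ring) ?_ ?_ ?_
  · linear_combination -d ^ 2 * C μ ^ 2 * hεC - d ^ 2 * hμC
  · rw [he]
    linear_combination (a ^ 2 - C ε ^ 2 * d ^ 2) * hμC
  · rw [hf]
    linear_combination d ^ 2 * hδC + 2 * b * d * hC + b ^ 2 * hνC - d ^ 2 * C μ ^ 2 * hεC
      - d ^ 2 * hμC

lemma IsFrame.isCritical_of_add_eq_zero (h : IsFrame a b c d e f) (hc : a + b + c = 0) :
    IsCritical a b c d e f := by
  have hc' : c = -(a + b) := by linear_combination hc
  by_cases ha : a = 0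
  · by_cases hb : b = 0
    · exact isCritical_of_triangle ha hb (by rw [hc', ha, hb]; simp)
    · have h1 : IsFrame b a c d f e := h.swap12
      refine IsCritical.swap12 ?_
      have ha' : a = C 0 * b := by simp [ha]
      rw [ha'] at h1 hc' ⊢
      exact h1.isCritical_of_proportional (by rw [hc']; ring) hb
  · by_cases hab : IsMultiple a b
    · obtain ⟨κ, rfl⟩ := hab
      exact h.isCritical_of_proportional hc' ha
    · exact h.isCritical_of_not_isMultiple hc' ha hab

end Frames

/-! ### Heron factors of the four triangles -/

section Heron

variable {σ : Type*}

/-- The four linear factors of Heron's formula, with signs such that their sum is zero. -/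
def heron {R : Type*} [CommRing R] (a b c : R) : Fin 4 → R :=
  ![a + b + c, a - b - c, -a + b - c, -a - b + c]

lemma sum_heron {R : Type*} [CommRing R] (a b c : R) : ∑ i, heron a b c i = 0 := by
  simp only [heron, Fin.sum_univ_four, Matrix.cons_val]
  ring

lemma heron_isHomogeneous {a b c : MvPolynomial σ ℂ} (ha : a.IsHomogeneous 1)
    (hb : b.IsHomogeneous 1) (hc : c.IsHomogeneous 1) (i : Fin 4) :
    (heron a b c i).IsHomogeneous 1 := by
  fin_cases i
  · exact (ha.add hb).add hc
  · exact (ha.sub hb).sub hc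
  · exact (ha.neg.add hb).sub hc
  · exact (ha.neg.sub hb).add hc

lemma heron_mem {a b c : MvPolynomial σ ℂ} {N : Submodule ℂ (MvPolynomial σ ℂ)} :
    (∀ i, heron a b c i ∈ N) ↔ a ∈ N ∧ b ∈ N ∧ c ∈ N := by
  constructor
  · intro h
    have h2 : ∀ {x y z : MvPolynomial σ ℂ}, x ∈ N → y ∈ N → x + y = 2 * z → z ∈ N := by
      intro x y z hx hy hz
      refine mem_of_C_mul_mem (c := 2) two_ne_zero ?_
      rw [map_ofNat, ← hz]
      exact add_mem hx hy
    refine ⟨h2 (h 0) (h 1) ?_, h2 (h 0) (h 2) ?_, h2 (h 0) (h 3) ?_⟩ <;>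
      simp only [heron, Matrix.cons_val] <;> ring
  · rintro ⟨ha, hb, hc⟩ i
    fin_cases i
    · exact add_mem (add_mem ha hb) hc
    · exact sub_mem (sub_mem ha hb) hc
    · exact sub_mem (add_mem (neg_mem ha) hb) hc
    · exact add_mem (sub_mem (neg_mem ha) hb) hc

variable {a b c d e f : MvPolynomial σ ℂ}

lemma IsFrame.isCritical_of_heron_eq_zero (h : IsFrame a b c d e f) {i : Fin 4}
    (hi : heron a b c i = 0) : IsCritical a b c d e f := by
  have hneg : ∀ {a b c d e f : MvPolynomial σ ℂ}, IsFrame a b c d e f → a - b - c = 0 →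
      IsCritical a b c d e f := by
    intro a b c d e f h h0
    have := (h.neg_bc.isCritical_of_add_eq_zero (by linear_combination h0)).neg_bc
    rwa [neg_neg, neg_neg] at this
  fin_cases i
  · exact h.isCritical_of_add_eq_zero hi
  · exact hneg h hi
  · refine (hneg h.swap12 ?_).swap12
    change -a + b - c = 0 at hi
    linear_combination hi
  · refine (hneg h.swap01.swap12 ?_).swap12.swap01
    change -a - b + c = 0 at hi
    linear_combination hi

/-- The linear factors of Heron's formula for the four triangles. -/
noncomputable def heronRows (a b c d e f : MvPolynomial σ ℂ) :
    Fin 4 → Fin 4 → MvPolynomial σ ℂ :=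
  ![heron a b c, heron a d e, heron b d f, heron c e f]

lemma IsFrame.isCritical_of_heronRows_eq_zero (h : IsFrame a b c d e f) {t i : Fin 4}
    (hi : heronRows a b c d e f t i = 0) : IsCritical a b c d e f := by
  fin_cases t
  · exact h.isCritical_of_heron_eq_zero hi
  · exact (h.swap23.isCritical_of_heron_eq_zero hi).swap23
  · exact (h.swap12.swap23.isCritical_of_heron_eq_zero hi).swap23.swap12
  · exact (h.swap01.swap12.swap23.isCritical_of_heron_eq_zero hi).swap23.swap12.swap01

/-- Jacobi's identity for minors: the product of the two principal minors belonging to two triangles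
differs from the square of a cofactor by a multiple of the determinant. The cofactor is that of the
edge opposite to the common edge. -/
lemma IsFrame.exists_prod_mul_prod_eq_sq (h : IsFrame a b c d e f) {t t' : Fin 4} (ht : t ≠ t') :
    ∃ q, (∏ i, heronRows a b c d e f t i) * ∏ i, heronRows a b c d e f t' i = q ^ 2 := by
  wlog hlt : t < t' generalizing t t'
  · obtain ⟨q, hq⟩ := this ht.symm (lt_of_le_of_ne (not_lt.mp hlt) ht.symm)
    exact ⟨q, by rw [← hq, mul_comm]⟩
  have h0 := h.eq_zero
  unfold cayleyMenger at h0
  fin_cases t <;> fin_cases t' <;>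
    first
    | exact absurd hlt (by decide)
    | simp only [heronRows, heron, Fin.prod_univ_four, Matrix.cons_val, Fin.zero_eta, Fin.mk_one,
        Fin.reduceFinMk]
  · exact ⟨stress f b d c e a, by unfold stress; linear_combination 2 * a ^ 2 * h0⟩
  · exact ⟨stress e c f a d b, by unfold stress; linear_combination 2 * b ^ 2 * h0⟩
  · exact ⟨stress d b f a e c, by unfold stress; linear_combination 2 * c ^ 2 * h0⟩
  · exact ⟨stress c a b e f d, by unfold stress; linear_combination 2 * d ^ 2 * h0⟩
  · exact ⟨stress b a c d f e, by unfold stress; linear_combination 2 * e ^ 2 * h0⟩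
  · exact ⟨stress a b c d e f, by unfold stress; linear_combination 2 * f ^ 2 * h0⟩

lemma IsFrame.heronRows_isHomogeneous (h : IsFrame a b c d e f) (t i : Fin 4) :
    (heronRows a b c d e f t i).IsHomogeneous 1 := by
  fin_cases t
  · exact heron_isHomogeneous h.ha h.hb h.hc i
  · exact heron_isHomogeneous h.ha h.hd h.he i
  · exact heron_isHomogeneous h.hb h.hd h.hf i
  · exact heron_isHomogeneous h.hc h.he h.hf i

lemma sum_heronRows (t : Fin 4) : ∑ i, heronRows a b c d e f t i = 0 := by
  fin_cases t <;> exact sum_heron _ _ _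

lemma IsFrame.exists_partner (h : IsFrame a b c d e f)
    (hne : ∀ t i, heronRows a b c d e f t i ≠ 0) {t t' : Fin 4} (ht : t ≠ t') (i : Fin 4) :
    (∃ j, j ≠ i ∧ IsMultiple (heronRows a b c d e f t i) (heronRows a b c d e f t j)) ∨
      ∃ j, IsMultiple (heronRows a b c d e f t i) (heronRows a b c d e f t' j) := by
  obtain ⟨q, hq⟩ := h.exists_prod_mul_prod_eq_sq ht
  exact exists_isMultiple_of_prod_mul_prod_eq_sq (h.heronRows_isHomogeneous t)
    (h.heronRows_isHomogeneous t') (hne t) hq i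

lemma IsFrame.not_heronRows_mem (h : IsFrame a b c d e f) (u v : MvPolynomial σ ℂ) :
    ¬ ∀ t i, heronRows a b c d e f t i ∈ Submodule.span ℂ {u, v} := by
  intro hm
  obtain ⟨ha, hb, hc⟩ := heron_mem.mp (hm 0)
  obtain ⟨-, hd, he⟩ := heron_mem.mp (hm 1)
  obtain ⟨-, -, hf⟩ := heron_mem.mp (hm 2)
  exact h.spans u v ha hb hc hd he hf

lemma exists_complement {i j : Fin 4} (hij : i ≠ j) :
    ∃ l m : Fin 4, i ≠ l ∧ i ≠ m ∧ j ≠ l ∧ j ≠ m ∧ l ≠ m := by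
  revert i j; decide

lemma eq_or_of_distinct {i j l m : Fin 4} (hij : i ≠ j) (hil : i ≠ l) (him : i ≠ m) (hjl : j ≠ l)
    (hjm : j ≠ m) (hlm : l ≠ m) (n : Fin 4) : n = i ∨ n = j ∨ n = l ∨ n = m := by
  revert i j l m n; decide

lemma sum_of_distinct {M : Type*} [AddCommMonoid M] {i j l m : Fin 4} (hij : i ≠ j) (hil : i ≠ l)
    (him : i ≠ m) (hjl : j ≠ l) (hjm : j ≠ m) (hlm : l ≠ m) (k : Fin 4 → M) :
    ∑ n, k n = k i + k j + k l + k m := by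
  have h : (Finset.univ : Finset (Fin 4)) = {i, j, l, m} := by
    ext n
    simpa using eq_or_of_distinct hij hil him hjl hjm hlm n
  rw [h, Finset.sum_insert (by simp [hij, hil, him]), Finset.sum_insert (by simp [hjl, hjm]),
    Finset.sum_insert (by simp [hlm]), Finset.sum_singleton]
  simp only [add_assoc]

/-- Four forms with sum zero and one proportional pair have rank at most two. -/
lemma mem_span_of_isMultiple {k : Fin 4 → MvPolynomial σ ℂ} (hs : ∑ i, k i = 0)
    {i j l m : Fin 4} (hij : i ≠ j) (hil : i ≠ l) (him : i ≠ m) (hjl : j ≠ l)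
    (hjm : j ≠ m) (hlm : l ≠ m) (hk : IsMultiple (k i) (k j)) (n : Fin 4) :
    k n ∈ Submodule.span ℂ {k i, k l} := by
  have h1 := left_mem_span_pair (k i) (k l)
  have h2 := right_mem_span_pair (k i) (k l)
  have h3 := hk.mem h1
  rw [sum_of_distinct hij hil him hjl hjm hlm] at hs
  rcases eq_or_of_distinct hij hil him hjl hjm hlm n with rfl | rfl | rfl | rfl
  · exact h1
  · exact h3
  · exact h2
  · rw [show k n = -(k i + k j + k l) by linear_combination hs]
    exact neg_mem (add_mem (add_mem h1 h3) h2)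

lemma span_pair_le_span_pair {u v x y : MvPolynomial σ ℂ} (hx0 : x ≠ 0) (hxy : ¬ IsMultiple x y)
    (hx : x ∈ Submodule.span ℂ {u, v}) (hy : y ∈ Submodule.span ℂ {u, v}) :
    Submodule.span ℂ {u, v} ≤ Submodule.span ℂ {x, y} := by
  have hle : Submodule.span ℂ {x, y} ≤ Submodule.span ℂ {u, v} := by
    rw [Submodule.span_le]
    rintro z (rfl | rfl)
    · exact hx
    · exact hy
  have hli : LinearIndependent ℂ ![x, y] := by
    rw [LinearIndependent.pair_iff' hx0]
    intro c hc
    exact hxy ⟨c, by rw [← hc, smul_eq_C_mul]⟩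
  have h2 : Module.finrank ℂ (Submodule.span ℂ {x, y}) = 2 := by
    have := finrank_span_eq_card hli
    rwa [Matrix.range_cons, Matrix.range_cons, Matrix.range_empty, Set.union_empty,
      Set.singleton_union, Fintype.card_fin] at this
  have h3 : Module.finrank ℂ (Submodule.span ℂ {u, v}) ≤ 2 := by
    classical
    have := finrank_span_finset_le_card (R := ℂ) ({u, v} : Finset (MvPolynomial σ ℂ))
    rw [Finset.coe_pair] at this
    exact this.trans Finset.card_le_two
  have : Module.Finite ℂ (Submodule.span ℂ {u, v}) :=
    Module.Finite.span_of_finite ℂ (Set.toFinite _)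
  exact (Submodule.eq_of_le_of_finrank_le hle (by rw [h2]; exact h3)).ge

/-- If every row of Heron factors contains a proportional pair, then the complementary pairs are
proportional as well. -/
lemma IsFrame.isMultiple_complement (h : IsFrame a b c d e f)
    (hne : ∀ t i, heronRows a b c d e f t i ≠ 0)
    (hpair : ∀ t, ∃ i j, i ≠ j ∧
      IsMultiple (heronRows a b c d e f t i) (heronRows a b c d e f t j))
    (t : Fin 4) {i j l m : Fin 4} (hij : i ≠ j) (hil : i ≠ l) (him : i ≠ m) (hjl : j ≠ l)
    (hjm : j ≠ m) (hlm : l ≠ m)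
    (hk : IsMultiple (heronRows a b c d e f t i) (heronRows a b c d e f t j)) :
    IsMultiple (heronRows a b c d e f t l) (heronRows a b c d e f t m) := by
  by_contra hn
  set k := heronRows a b c d e f t with hkdef
  have hsum : ∑ n, k n = 0 := sum_heronRows t
  have hs := hsum
  rw [sum_of_distinct hij hil him hjl hjm hlm] at hs
  obtain ⟨r, hr⟩ := hk
  have hni : ¬ IsMultiple (k l) (k i) := by
    rintro ⟨s, hs'⟩
    refine hn ⟨-(s + r * s + 1), ?_⟩
    simp only [C_neg, C_add, C_mul, C_1]
    linear_combination hs - hr - (1 + C r) * hs'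
  have hnj : ¬ IsMultiple (k l) (k j) := fun h' =>
    hni (h'.trans (IsMultiple.symm ⟨r, hr⟩ (hne t j)))
  have hni' : ¬ IsMultiple (k m) (k i) := by
    rintro ⟨s, hs'⟩
    refine hn (IsMultiple.symm ⟨-(s + r * s + 1), ?_⟩ (hne t l))
    simp only [C_neg, C_add, C_mul, C_1]
    linear_combination hs - hr - (1 + C r) * hs'
  have hnj' : ¬ IsMultiple (k m) (k j) := fun h' =>
    hni' (h'.trans (IsMultiple.symm ⟨r, hr⟩ (hne t j)))
  -- The factors `k l` and `k m` have no partner in their own row, so each has one in every other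
  -- row. Every row has rank at most two, so these two independent forms span all rows.
  refine h.not_heronRows_mem (k l) (k m) fun t' n => ?_
  obtain ⟨u, v, hu⟩ : ∃ u v, ∀ n, heronRows a b c d e f t' n ∈ Submodule.span ℂ {u, v} := by
    obtain ⟨i', j', hij', hk'⟩ := hpair t'
    obtain ⟨l', m', h1, h2, h3, h4, h5⟩ := exists_complement hij'
    exact ⟨_, _, mem_span_of_isMultiple (sum_heronRows t') hij' h1 h2 h3 h4 h5 hk'⟩
  have mem : ∀ n, (∀ n', n' ≠ n → ¬ IsMultiple (k n) (k n')) → k n ∈ Submodule.span ℂ {u, v} := by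
    intro n hn'
    by_cases htt : t = t'
    · subst htt
      exact hu n
    · rcases h.exists_partner hne htt n with ⟨n', h1, h2⟩ | ⟨n', h1⟩
      · exact absurd h2 (hn' n' h1)
      · exact (h1.symm (hne t' n')).mem (hu n')
  refine span_pair_le_span_pair (hne t l) hn (mem l ?_) (mem m ?_) (hu n)
  · intro n' hn' h'
    rcases eq_or_of_distinct hij hil him hjl hjm hlm n' with rfl | rfl | rfl | rfl
    · exact hni h'
    · exact hnj h'
    · exact hn' rfl
    · exact hn h'
  · intro n' hn' h'
    rcases eq_or_of_distinct hij hil him hjl hjm hlm n' with rfl | rfl | rfl | rfl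
    · exact hni' h'
    · exact hnj' h'
    · exact hn (h'.symm (hne t n'))
    · exact hn' rfl

/-- A zero edge, or all edges proportional. -/
def IsFlat (a b c : MvPolynomial σ ℂ) : Prop :=
  a = 0 ∨ b = 0 ∨ c = 0 ∨ (IsMultiple a b ∧ IsMultiple a c)

/-- The two pairs are `a ± (b + c)` and, up to sign, `a ± (c - b)`. If `a + x` and `a - x` are
proportional, then `a = 0` or `x` is a multiple of `a`. -/
lemma eq_zero_or_of_isMultiple {a b c : MvPolynomial σ ℂ}
    (h1 : IsMultiple (a + b + c) (a - b - c)) (h2 : IsMultiple (-a + b - c) (-a - b + c)) :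
    a = 0 ∨ (IsMultiple a b ∧ IsMultiple a c) := by
  have key : ∀ {x : MvPolynomial σ ℂ}, IsMultiple (a + x) (a - x) → a = 0 ∨ IsMultiple a x := by
    rintro x ⟨r, hr⟩
    by_cases hr1 : 1 + r = 0
    · left
      have : r = -1 := by linear_combination hr1
      rw [this, C_neg, C_1] at hr
      have h2 : (2 : MvPolynomial σ ℂ) * a = 0 := by linear_combination hr
      exact (mul_eq_zero.mp h2).resolve_left two_ne_zero
    · right
      refine ⟨(1 + r)⁻¹ * (1 - r), ?_⟩
      have h3 : C ((1 + r)⁻¹) * (1 + C r) = (1 : MvPolynomial σ ℂ) := by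
        rw [← C_1, ← C_add, ← C_mul, inv_mul_cancel₀ hr1]
      simp only [C_mul, C_sub, C_1]
      linear_combination -x * h3 - C ((1 + r)⁻¹) * hr
  have h1' : a = 0 ∨ IsMultiple a (b + c) := key (by
    rwa [← add_assoc, ← sub_sub])
  have h2' : a = 0 ∨ IsMultiple a (c - b) := key (by
    obtain ⟨r, hr⟩ := h2
    exact ⟨r, by linear_combination -hr⟩)
  rcases h1' with h | ⟨r, hr⟩
  · exact .inl h
  rcases h2' with h | ⟨s, hs⟩
  · exact .inl h
  have e : (C (1 / 2 : ℂ) : MvPolynomial σ ℂ) * 2 = 1 := by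
    rw [← map_ofNat C 2, ← C_mul]; norm_num
  refine .inr ⟨⟨1 / 2 * (r - s), ?_⟩, ⟨1 / 2 * (r + s), ?_⟩⟩
  · simp only [C_mul, C_sub]
    linear_combination C (1 / 2) * (hr - hs) - b * e
  · simp only [C_mul, C_add]
    linear_combination C (1 / 2) * (hr + hs) - c * e

end Heron

/-! ### Flat triangles -/

section Flat

variable {σ : Type*} {a b c d e f : MvPolynomial σ ℂ}

lemma IsFlat.swap_right (h : IsFlat a b c) : IsFlat a c b := by
  rcases h with h | h | h | ⟨h1, h2⟩
  · exact .inl h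
  · exact .inr (.inr (.inl h))
  · exact .inr (.inl h)
  · exact .inr (.inr (.inr ⟨h2, h1⟩))

lemma IsFlat.swap (h : IsFlat a b c) : IsFlat b a c := by
  by_cases hb : b = 0
  · exact .inl hb
  rcases h with h | h | h | ⟨h1, h2⟩
  · exact .inr (.inl h)
  · exact absurd h hb
  · exact .inr (.inr (.inl h))
  · exact .inr (.inr (.inr ⟨h1.symm hb, (h1.symm hb).trans h2⟩))

/-- Each of the three ways to split the four factors into two pairs singles out one edge, and
complementary pairs are proportional together. -/
lemma isFlat_of_isMultiple_heron
    (h : ∃ i j : Fin 4, i ≠ j ∧ IsMultiple (heron a b c i) (heron a b c j))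
    (hcompl : ∀ {i j l m : Fin 4}, i ≠ j → i ≠ l → i ≠ m → j ≠ l → j ≠ m → l ≠ m →
      IsMultiple (heron a b c i) (heron a b c j) → IsMultiple (heron a b c l) (heron a b c m))
    (hne : ∀ i, heron a b c i ≠ 0) : IsFlat a b c := by
  have case1 : IsMultiple (heron a b c 0) (heron a b c 1) →
      IsMultiple (heron a b c 2) (heron a b c 3) → IsFlat a b c := by
    intro h1 h2
    rcases eq_zero_or_of_isMultiple (a := a) (b := b) (c := c) h1 h2 with h | h
    · exact .inl h
    · exact .inr (.inr (.inr h))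
  have case2 : IsMultiple (heron a b c 0) (heron a b c 2) →
      IsMultiple (heron a b c 1) (heron a b c 3) → IsFlat a b c := by
    rintro ⟨r, hr⟩ ⟨s, hs⟩
    simp only [heron, Matrix.cons_val] at hr hs
    rcases eq_zero_or_of_isMultiple (a := b) (b := a) (c := c)
      ⟨r, by linear_combination hr⟩ ⟨s, by linear_combination hs⟩ with h | ⟨h1, h2⟩
    · exact .inr (.inl h)
    · by_cases ha : a = 0
      · exact .inl ha
      · exact .inr (.inr (.inr ⟨h1.symm ha, (h1.symm ha).trans h2⟩))
  have case3 : IsMultiple (heron a b c 0) (heron a b c 3) →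
      IsMultiple (heron a b c 2) (heron a b c 1) → IsFlat a b c := by
    rintro ⟨r, hr⟩ ⟨s, hs⟩
    simp only [heron, Matrix.cons_val] at hr hs
    rcases eq_zero_or_of_isMultiple (a := c) (b := b) (c := a)
      ⟨r, by linear_combination hr⟩ ⟨s, by linear_combination hs⟩ with h | ⟨h1, h2⟩
    · exact .inr (.inr (.inl h))
    · by_cases ha : a = 0
      · exact .inl ha
      · exact .inr (.inr (.inr ⟨(h2.symm ha).trans h1, h2.symm ha⟩))
  have compl : ∀ p q r s : Fin 4, p ≠ q ∧ p ≠ r ∧ p ≠ s ∧ q ≠ r ∧ q ≠ s ∧ r ≠ s →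
      IsMultiple (heron a b c p) (heron a b c q) → IsMultiple (heron a b c r) (heron a b c s) :=
    fun p q r s ⟨h1, h2, h3, h4, h5, h6⟩ hm => hcompl h1 h2 h3 h4 h5 h6 hm
  obtain ⟨i, j, hij, hm⟩ := h
  wlog hlt : i < j generalizing i j
  · exact this j i hij.symm (hm.symm (hne j)) (lt_of_le_of_ne (not_lt.mp hlt) hij.symm)
  fin_cases i <;> fin_cases j <;> first | exact absurd hlt (by decide) | skip
  · exact case1 hm (compl 0 1 2 3 (by decide) hm)
  · exact case2 hm (compl 0 2 1 3 (by decide) hm)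
  · exact case3 hm (compl 0 3 2 1 (by decide) hm)
  · exact case3 (compl 1 2 0 3 (by decide) hm) (hm.symm (hne 2))
  · exact case2 (compl 1 3 0 2 (by decide) hm) hm
  · exact case1 (compl 2 3 0 1 (by decide) hm) hm

/-- Flat triangles with a common zero edge. -/
lemma IsFrame.false_of_eq_zero (h : IsFrame a b c d e f) (ha : a = 0)
    (hne : ∀ t i, heronRows a b c d e f t i ≠ 0) (h2 : IsFlat b d f) (h3 : IsFlat c e f) :
    False := by
  have h0 := h.eq_zero
  have hβ : b ^ 2 - c ^ 2 ≠ 0 := by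
    have h1 := hne 0 0
    have h2 := hne 0 2
    simp only [heronRows, heron, Matrix.cons_val, ha] at h1 h2
    intro h3
    refine mul_ne_zero h1 h2 ?_
    linear_combination h3
  have hγ : d ^ 2 - e ^ 2 ≠ 0 := by
    have h1 := hne 1 0
    have h2 := hne 1 2
    simp only [heronRows, heron, Matrix.cons_val, ha] at h1 h2
    intro h3
    refine mul_ne_zero h1 h2 ?_
    linear_combination h3
  -- The determinant at `a = 0`, divided by `-2`. The differences `b² - c²` and `d² - e²` are
  -- nonzero because no Heron factor vanishes.
  have hE : (b ^ 2 - c ^ 2) * (d ^ 2 - e ^ 2) * f ^ 2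
      + ((b ^ 2 - c ^ 2) * d ^ 2 - (d ^ 2 - e ^ 2) * b ^ 2)
        * ((b ^ 2 - c ^ 2) - (d ^ 2 - e ^ 2)) = 0 := by
    rw [ha, cayleyMenger] at h0
    have h2 : (-2 : MvPolynomial σ ℂ) ≠ 0 := by simp
    refine (mul_eq_zero.mp ?_).resolve_left h2
    linear_combination h0
  have ha0 : ∀ u v : MvPolynomial σ ℂ, a ∈ Submodule.span ℂ {u, v} := by
    intro u v; rw [ha]; exact zero_mem _
  have z0 : ∀ {x : MvPolynomial σ ℂ}, x = 0 → ∀ u v : MvPolynomial σ ℂ,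
      x ∈ Submodule.span ℂ {u, v} := by
    rintro x rfl u v; exact zero_mem _
  have L := fun u v : MvPolynomial σ ℂ => left_mem_span_pair u v
  have R := fun u v : MvPolynomial σ ℂ => right_mem_span_pair u v
  by_cases hf : f = 0
  · have hE' : ((b * e) ^ 2 - (c * d) ^ 2) * ((b ^ 2 - d ^ 2) - (c ^ 2 - e ^ 2)) = 0 := by
      rw [hf] at hE; linear_combination hE
    rcases mul_eq_zero.mp hE' with h1 | h1
    · rcases sq_eq_sq_iff_eq_or_eq_neg.mp (sub_eq_zero.mp h1) with h1 | h1
      · obtain ⟨u, v, k1, k2, k3, k4⟩ := exists_mem_span_pair_of_mul_eq_mul h.hb h.hc h.hd h1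
        exact h.spans u v (ha0 _ _) k1 k3 k4 k2 (z0 hf _ _)
      · obtain ⟨u, v, k1, k2, k3, k4⟩ := exists_mem_span_pair_of_mul_eq_mul h.hb h.hc.neg h.hd
          (h1.trans (neg_mul _ _).symm)
        exact h.spans u v (ha0 _ _) k1 (by simpa using neg_mem k3) k4 k2 (z0 hf _ _)
    · obtain ⟨u, v, k1, k2, k3, k4⟩ := exists_mem_span_pair_of_mul_eq_mul
        (p := b + d) (q := b - d) (r := c + e) (s := c - e) (h.hb.add h.hd) (h.hc.add h.he)
        (h.hc.sub h.he) (by linear_combination h1)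
      obtain ⟨kb, kd⟩ := mem_of_add_mem_of_sub_mem k1 k2
      obtain ⟨kc, ke⟩ := mem_of_add_mem_of_sub_mem k3 k4
      exact h.spans u v (ha0 _ _) kb kc kd ke (z0 hf _ _)
  rcases h2 with hb | hd | hf' | ⟨hbd, hbf⟩
  · have hc : c ^ 2 ≠ 0 := by
      intro hc; apply hβ; rw [hb, hc]; ring
    rcases h3 with hc' | he | hf' | ⟨hce, hcf⟩
    · exact hc (by rw [hc']; ring)
    · have hd : d ^ 2 ≠ 0 := by
        intro hd; apply hγ; rw [he, hd]; ring
      have h1 : f ^ 2 - c ^ 2 - d ^ 2 = 0 := by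
        refine (mul_eq_zero.mp ?_).resolve_left (mul_ne_zero hc hd)
        rw [hb, he] at hE
        linear_combination -hE
      obtain ⟨u, v, k1, k2, k3, -⟩ := exists_mem_span_pair_of_mul_eq_mul
        (p := f + c) (q := f - c) (r := d) (s := d) (h.hf.add h.hc) h.hd h.hd
        (by linear_combination h1)
      obtain ⟨kf, kc⟩ := mem_of_add_mem_of_sub_mem k1 k2
      exact h.spans u v (ha0 _ _) (z0 hb _ _) kc k3 (z0 he _ _) kf
    · exact hf hf'
    · exact h.spans c d (ha0 _ _) (z0 hb _ _) (L _ _) (R _ _) (hce.mem (L _ _)) (hcf.mem (L _ _))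
  · have he : e ^ 2 ≠ 0 := by
      intro he; apply hγ; rw [hd, he]; ring
    rcases h3 with hc | he' | hf' | ⟨hce, hcf⟩
    · have hb : b ^ 2 ≠ 0 := by
        intro hb; apply hβ; rw [hc, hb]; ring
      have h1 : f ^ 2 - b ^ 2 - e ^ 2 = 0 := by
        refine (mul_eq_zero.mp ?_).resolve_left (mul_ne_zero hb he)
        rw [hc, hd] at hE
        linear_combination -hE
      obtain ⟨u, v, k1, k2, k3, -⟩ := exists_mem_span_pair_of_mul_eq_mul
        (p := f + b) (q := f - b) (r := e) (s := e) (h.hf.add h.hb) h.he h.he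
        (by linear_combination h1)
      obtain ⟨kf, kb⟩ := mem_of_add_mem_of_sub_mem k1 k2
      exact h.spans u v (ha0 _ _) kb (z0 hc _ _) (z0 hd _ _) k3 kf
    · exact he (by rw [he']; ring)
    · exact hf hf'
    · exact h.spans c b (ha0 _ _) (R _ _) (L _ _) (z0 hd _ _) (hce.mem (L _ _)) (hcf.mem (L _ _))
  · exact hf hf'
  · rcases h3 with hc | he | hf' | ⟨hce, hcf⟩
    · exact h.spans b e (ha0 _ _) (L _ _) (z0 hc _ _) (hbd.mem (L _ _)) (R _ _) (hbf.mem (L _ _))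
    · exact h.spans b c (ha0 _ _) (L _ _) (R _ _) (hbd.mem (L _ _)) (z0 he _ _) (hbf.mem (L _ _))
    · exact hf hf'
    · exact h.spans b c (ha0 _ _) (L _ _) (R _ _) (hbd.mem (L _ _)) (hce.mem (R _ _))
        (hbf.mem (L _ _))

end Flat

/-! ### Triangles with pairwise non-proportional Heron factors -/

section Disphenoid

variable {σ : Type*} {a b c d e f : MvPolynomial σ ℂ}

/-- The index of the edge `x` such that the sum of two Heron factors is `±2 x`. -/
def pairIndex : Fin 4 → Fin 4 → Fin 3 :=
  ![![0, 0, 1, 2], ![0, 0, 2, 1], ![1, 2, 0, 0], ![2, 1, 0, 0]]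

lemma heron_add_heron_sq {R : Type*} [CommRing R] (a b c : R) {p q : Fin 4} (hpq : p ≠ q) :
    (heron a b c p + heron a b c q) ^ 2 = 4 * ![a, b, c] (pairIndex p q) ^ 2 := by
  fin_cases p <;> fin_cases q <;>
    first
    | exact absurd rfl hpq
    | simp only [heron, pairIndex, Matrix.cons_val, Fin.zero_eta, Fin.mk_one, Fin.reduceFinMk]
      ring

lemma pairIndex_injective {p q r : Fin 4} (hpq : p ≠ q) (hpr : p ≠ r) (hqr : q ≠ r) :
    pairIndex p q ≠ pairIndex p r := by
  revert p q r; decide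

/-- If three linearly independent forms have the same Heron factors, up to scalars, as three other
forms, then the squares of the other forms are multiples of the squares of the first ones. -/
lemma exists_sq_eq_of_heron_isMultiple {a' b' c' : MvPolynomial σ ℂ}
    (hind : ∀ x y z : ℂ, C x * a + C y * b + C z * c = 0 → x = 0 ∧ y = 0 ∧ z = 0)
    (hn : ∀ i j, i ≠ j → ¬ IsMultiple (heron a b c i) (heron a b c j))
    (hne' : ∀ i, heron a' b' c' i ≠ 0)
    (h : ∀ i, ∃ j, IsMultiple (heron a b c i) (heron a' b' c' j)) :
    ∃ (r : ℂ) (π : Fin 3 → Fin 3), Function.Injective π ∧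
      ∀ n, ![a', b', c'] n ^ 2 = C r * ![a, b, c] (π n) ^ 2 := by
  choose s r hr using h
  have hr0 : ∀ i, r i ≠ 0 := by
    intro i hi
    have := hr i
    rw [hi, C_0, zero_mul] at this
    exact hne' _ this
  have hinj : Function.Injective s := by
    intro i j hij
    by_contra hne
    refine hn i j hne ?_
    have h1 : IsMultiple (heron a b c j) (heron a' b' c' (s i)) := ⟨r j, by rw [hij, hr j]⟩
    exact IsMultiple.trans ⟨r i, hr i⟩ (h1.symm (hne' _))
  let τ : Equiv.Perm (Fin 4) := (Equiv.ofBijective s (Finite.injective_iff_bijective.mp hinj))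
  have hsum : ∑ i, C (r i) * heron a b c i = 0 := by
    rw [← sum_heron a' b' c', ← Equiv.sum_comp τ (heron a' b' c')]
    exact Finset.sum_congr rfl fun i _ => (hr i).symm
  have hτ : ∀ i, s (τ.symm i) = i := fun i => τ.apply_symm_apply i
  rw [Fin.sum_univ_four] at hsum
  simp only [heron, Matrix.cons_val] at hsum
  -- For independent edges the vanishing sum is the only linear relation between the Heron factors
  -- up to scaling, so all four ratios agree.
  obtain ⟨h1, h2, h3⟩ := hind (r 0 + r 1 - r 2 - r 3) (r 0 - r 1 + r 2 - r 3)
    (r 0 - r 1 - r 2 + r 3) (by simp only [C_add, C_sub]; linear_combination hsum)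
  have hrr : ∀ i, r i = r 0 := by
    intro i
    fin_cases i
    · rfl
    · change r 1 = r 0; linear_combination -(h2 + h3) / 2
    · change r 2 = r 0; linear_combination -(h1 + h3) / 2
    · change r 3 = r 0; linear_combination -(h1 + h2) / 2
  have hk : ∀ i, heron a' b' c' i = C (r 0) * heron a b c (τ.symm i) := by
    intro i
    have := hr (τ.symm i)
    rwa [hτ, hrr] at this
  have hsq : ∀ {p q : Fin 4}, p ≠ q → ![a', b', c'] (pairIndex p q) ^ 2
      = C (r 0 ^ 2) * ![a, b, c] (pairIndex (τ.symm p) (τ.symm q)) ^ 2 := by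
    intro p q hpq
    have h1 := heron_add_heron_sq a' b' c' hpq
    have h2 := heron_add_heron_sq a b c (τ.symm.injective.ne hpq)
    rw [hk, hk] at h1
    have h4 : (4 : MvPolynomial σ ℂ) ≠ 0 := by simp
    refine mul_left_cancel₀ h4 ?_
    rw [C_pow]
    linear_combination -h1 + C (r 0) ^ 2 * h2
  -- A permutation of the four factors permutes their three splittings into pairs, that is, the
  -- edges; the edge `n` is read off from the pair `0, n + 1`.
  refine ⟨r 0 ^ 2, fun n => pairIndex (τ.symm 0) (τ.symm n.succ), ?_, ?_⟩
  · intro m n hmn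
    by_contra hne
    exact pairIndex_injective (τ.symm.injective.ne (Fin.succ_ne_zero m).symm)
      (τ.symm.injective.ne (Fin.succ_ne_zero n).symm)
      (τ.symm.injective.ne (fun h => hne (Fin.succ_injective _ h))) hmn
  · intro n
    have h1 : pairIndex 0 n.succ = n := by fin_cases n <;> rfl
    have h2 := hsq (Fin.succ_ne_zero n).symm
    rwa [h1] at h2

lemma isMultiple_of_sq_eq_C_mul_sq {p q : MvPolynomial σ ℂ} {r : ℂ} (hp : p.IsHomogeneous 1)
    (hq : q.IsHomogeneous 1) (hp0 : p ≠ 0) (h : p ^ 2 = C r * q ^ 2) : IsMultiple p q := by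
  have hpr := prime_of_isHomogeneous_one hp hp0
  have h1 : p ∣ C r * q ^ 2 := ⟨p, by rw [← h, sq]⟩
  rcases hpr.dvd_or_dvd h1 with h2 | h2
  · have hr : r ≠ 0 := by
      rintro rfl
      rw [C_0, zero_mul] at h
      exact hp0 (pow_eq_zero_iff two_ne_zero |>.mp h)
    exact absurd (isUnit_of_dvd_unit h2 ((IsUnit.mk0 r hr).map C)) hpr.not_isUnit
  · exact isMultiple_of_dvd hp hq (hpr.dvd_of_dvd_pow h2)

/-- Two independent triangles with a common edge and proportional Heron factors have edges of
equal squares. -/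
lemma sq_eq_or_of_heron_isMultiple {d e : MvPolynomial σ ℂ} (ha : a.IsHomogeneous 1)
    (hb : b.IsHomogeneous 1) (hc : c.IsHomogeneous 1)
    (hind : ∀ x y z : ℂ, C x * a + C y * b + C z * c = 0 → x = 0 ∧ y = 0 ∧ z = 0)
    (hn : ∀ i j, i ≠ j → ¬ IsMultiple (heron a b c i) (heron a b c j))
    (hne' : ∀ i, heron a d e i ≠ 0)
    (h : ∀ i, ∃ j, IsMultiple (heron a b c i) (heron a d e j)) :
    (d ^ 2 = b ^ 2 ∧ e ^ 2 = c ^ 2) ∨ (d ^ 2 = c ^ 2 ∧ e ^ 2 = b ^ 2) := by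
  have ha0 : a ≠ 0 := by
    rintro rfl
    simpa using hind 1 0 0 (by simp)
  obtain ⟨r, π, hπ, hr⟩ := exists_sq_eq_of_heron_isMultiple hind hn hne' h
  have h0 := hr 0
  have h1 := hr 1
  have h2 := hr 2
  simp only [Matrix.cons_val] at h0 h1 h2
  have hπ0 : π 0 = 0 := by
    have hb' : ¬ IsMultiple a b := by
      rintro ⟨s, hs⟩
      have := hind (-s) 1 0 (by simp only [C_neg, C_1, C_0]; linear_combination hs)
      simp at this
    have hc' : ¬ IsMultiple a c := by
      rintro ⟨s, hs⟩
      have := hind (-s) 0 1 (by simp only [C_neg, C_1, C_0]; linear_combination hs)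
      simp at this
    generalize π 0 = n at h0 ⊢
    fin_cases n
    · rfl
    · exact absurd (isMultiple_of_sq_eq_C_mul_sq ha hb ha0 h0) hb'
    · exact absurd (isMultiple_of_sq_eq_C_mul_sq ha hc ha0 h0) hc'
  have hr1 : (C r : MvPolynomial σ ℂ) = 1 := by
    rw [hπ0] at h0
    simp only [Matrix.cons_val] at h0
    exact mul_right_cancel₀ (pow_ne_zero 2 ha0) (by linear_combination -h0)
  rw [hr1, one_mul] at h1 h2
  have n1 : π 1 ≠ 0 := fun h => absurd (hπ (h.trans hπ0.symm)) (by decide)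
  have n2 : π 2 ≠ 0 := fun h => absurd (hπ (h.trans hπ0.symm)) (by decide)
  have n12 : π 1 ≠ π 2 := fun h => absurd (hπ h) (by decide)
  generalize π 1 = m at h1 n1 n12
  generalize π 2 = n at h2 n2 n12
  fin_cases m <;> fin_cases n
  · exact absurd rfl n1
  · exact absurd rfl n1
  · exact absurd rfl n1
  · exact absurd rfl n2
  · exact absurd rfl n12
  · exact .inl ⟨h1, h2⟩
  · exact absurd rfl n2
  · exact .inr ⟨h1, h2⟩
  · exact absurd rfl n12

lemma heron_swap {R : Type*} [CommRing R] (a b c : R) (i : Fin 4) :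
    heron b a c i = heron a b c (Equiv.swap 1 2 i) := by
  fin_cases i
  · change b + a + c = a + b + c; ring
  · change b - a - c = -a + b - c; ring
  · change -b + a - c = a - b - c; ring
  · change -b - a + c = -a - b + c; ring

/-- No triangle has pairwise non-proportional Heron factors. -/
lemma IsFrame.exists_isMultiple_heron (h : IsFrame a b c d e f)
    (hne : ∀ t i, heronRows a b c d e f t i ≠ 0) :
    ∃ i j, i ≠ j ∧ IsMultiple (heron a b c i) (heron a b c j) := by
  by_contra! hn
  have partner : ∀ t', t' ≠ 0 → ∀ i, ∃ j,
      IsMultiple (heron a b c i) (heronRows a b c d e f t' j) := by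
    intro t' ht i
    rcases h.exists_partner hne ht.symm i with ⟨j, h1, h2⟩ | h1
    · exact absurd h2 (hn i j h1.symm)
    · exact h1
  have hspan : ∀ u v : MvPolynomial σ ℂ, a ∈ Submodule.span ℂ {u, v} →
      b ∈ Submodule.span ℂ {u, v} → c ∈ Submodule.span ℂ {u, v} → False := by
    intro u v ha hb hc
    have hk := heron_mem.mpr ⟨ha, hb, hc⟩
    refine h.not_heronRows_mem u v fun t n => ?_
    by_cases ht : t = 0
    · subst ht; exact hk n
    · choose s hs using partner t ht
      have hinj : Function.Injective s := by
        intro i j hij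
        by_contra hij'
        exact hn i j hij' ((hs i).trans (IsMultiple.symm (hij ▸ hs j) (hne t _)))
      obtain ⟨i, rfl⟩ := Finite.surjective_of_injective hinj n
      exact (hs i).mem (hk i)
  have hind : ∀ x y z : ℂ, C x * a + C y * b + C z * c = 0 → x = 0 ∧ y = 0 ∧ z = 0 := by
    have L := fun u v : MvPolynomial σ ℂ => left_mem_span_pair u v
    have R := fun u v : MvPolynomial σ ℂ => right_mem_span_pair u v
    intro x y z hxyz
    refine ⟨?_, ?_, ?_⟩ <;> by_contra hx
    · refine hspan b c (mem_of_C_mul_mem hx ?_) (L _ _) (R _ _)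
      rw [show C x * a = -(C y * b + C z * c) by linear_combination hxyz]
      exact neg_mem (add_mem (C_mul_mem _ (L _ _)) (C_mul_mem _ (R _ _)))
    · refine hspan a c (L _ _) (mem_of_C_mul_mem hx ?_) (R _ _)
      rw [show C y * b = -(C x * a + C z * c) by linear_combination hxyz]
      exact neg_mem (add_mem (C_mul_mem _ (L _ _)) (C_mul_mem _ (R _ _)))
    · refine hspan a b (L _ _) (R _ _) (mem_of_C_mul_mem hx ?_)
      rw [show C z * c = -(C x * a + C y * b) by linear_combination hxyz]
      exact neg_mem (add_mem (C_mul_mem _ (L _ _)) (C_mul_mem _ (R _ _)))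
  have hE1 := sq_eq_or_of_heron_isMultiple h.ha h.hb h.hc hind hn (hne 1) (partner 1 (by decide))
  have hE2 : (d ^ 2 = a ^ 2 ∧ f ^ 2 = c ^ 2) ∨ (d ^ 2 = c ^ 2 ∧ f ^ 2 = a ^ 2) := by
    refine sq_eq_or_of_heron_isMultiple h.hb h.ha h.hc ?_ ?_ (hne 2) ?_
    · intro x y z hxyz
      obtain ⟨h1, h2, h3⟩ := hind y x z (by linear_combination hxyz)
      exact ⟨h2, h1, h3⟩
    · intro i j hij
      rw [heron_swap a b c i, heron_swap a b c j]
      exact hn _ _ ((Equiv.swap 1 2).injective.ne hij)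
    · intro i
      rw [heron_swap]
      exact partner 2 (by decide) _
  have nsq : ∀ {x y : MvPolynomial σ ℂ}, x ^ 2 = y ^ 2 → IsMultiple y x := by
    intro x y hxy
    rcases sq_eq_sq_iff_eq_or_eq_neg.mp hxy with h | h
    · exact ⟨1, by simp [h]⟩
    · exact ⟨-1, by simp [h]⟩
  have hab : ¬ IsMultiple a b := by
    rintro ⟨s, hs⟩
    have := hind (-s) 1 0 (by simp only [C_neg, C_1, C_0]; linear_combination hs)
    simp at this
  have hac : ¬ IsMultiple a c := by
    rintro ⟨s, hs⟩
    have := hind (-s) 0 1 (by simp only [C_neg, C_1, C_0]; linear_combination hs)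
    simp at this
  have hbc : ¬ IsMultiple b c := by
    rintro ⟨s, hs⟩
    have := hind 0 (-s) 1 (by simp only [C_neg, C_1, C_0]; linear_combination hs)
    simp at this
  -- The triangles at the edges `a` and `b` share `d`, and no two of `a, b, c` are proportional, so
  -- `d` must match `c`: opposite edges have equal squares.
  obtain ⟨hd, he⟩ : d ^ 2 = c ^ 2 ∧ e ^ 2 = b ^ 2 := by
    rcases hE1 with ⟨h1, -⟩ | h1
    · rcases hE2 with ⟨h2, -⟩ | ⟨h2, -⟩
      · exact absurd (nsq (h1.symm.trans h2)) hab
      · exact absurd (nsq (h2.symm.trans h1)) hbc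
    · exact h1
  have hf : f ^ 2 = a ^ 2 := by
    rcases hE2 with ⟨h2, -⟩ | ⟨-, h2⟩
    · exact absurd (nsq (hd.symm.trans h2)) hac
    · exact h2
  have h0 := h.eq_zero
  have h1 : (a ^ 2 + b ^ 2 - c ^ 2) * ((a ^ 2 - b ^ 2 + c ^ 2) * (-a ^ 2 + b ^ 2 + c ^ 2)) = 0 := by
    simp only [cayleyMenger, hd, he, hf] at h0
    have h4 : (4 : MvPolynomial σ ℂ) ≠ 0 := by simp
    refine (mul_eq_zero.mp ?_).resolve_left h4
    linear_combination h0
  -- Each factor of the determinant is a Pythagorean relation `(z + y) (z - y) = x * x`, which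
  -- confines its forms to the span of two.
  have pyth : ∀ {x y z : MvPolynomial σ ℂ}, x.IsHomogeneous 1 → y.IsHomogeneous 1 →
      z.IsHomogeneous 1 → x ^ 2 + y ^ 2 = z ^ 2 → ∃ u v : MvPolynomial σ ℂ,
        x ∈ Submodule.span ℂ {u, v} ∧ y ∈ Submodule.span ℂ {u, v} ∧
          z ∈ Submodule.span ℂ {u, v} := by
    intro x y z hx hy hz hxyz
    obtain ⟨u, v, k1, k2, k3, -⟩ := exists_mem_span_pair_of_mul_eq_mul
      (p := z + y) (q := z - y) (r := x) (s := x) (hz.add hy) hx hx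
      (by linear_combination -hxyz)
    obtain ⟨kz, ky⟩ := mem_of_add_mem_of_sub_mem k1 k2
    exact ⟨u, v, k3, ky, kz⟩
  rcases mul_eq_zero.mp h1 with h1 | h1
  · obtain ⟨u, v, k1, k2, k3⟩ := pyth h.ha h.hb h.hc (by linear_combination h1)
    exact hspan u v k1 k2 k3
  rcases mul_eq_zero.mp h1 with h1 | h1
  · obtain ⟨u, v, k1, k2, k3⟩ := pyth h.ha h.hc h.hb (by linear_combination h1)
    exact hspan u v k1 k3 k2
  · obtain ⟨u, v, k1, k2, k3⟩ := pyth h.hb h.hc h.ha (by linear_combination h1)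
    exact hspan u v k3 k1 k2

end Disphenoid

/-! ### Linear subspaces of dimension at least three -/

section Classification

variable {σ : Type*} {a b c d e f : MvPolynomial σ ℂ}

/-- A linear family of edge lengths of rank at least three on which the Cayley–Menger determinant
vanishes consists of critical points. -/
theorem IsFrame.isCritical (h : IsFrame a b c d e f) : IsCritical a b c d e f := by
  by_contra hc
  have hne : ∀ t i, heronRows a b c d e f t i ≠ 0 := fun t i h0 =>
    hc (h.isCritical_of_heronRows_eq_zero h0)
  have ne1 : ∀ t i, heronRows a d e b c f t i ≠ 0 := fun t i h0 =>
    hc (h.swap23.isCritical_of_heronRows_eq_zero h0).swap23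
  have ne2 : ∀ t i, heronRows b d f a c e t i ≠ 0 := fun t i h0 =>
    hc (h.swap12.swap23.isCritical_of_heronRows_eq_zero h0).swap23.swap12
  have ne3 : ∀ t i, heronRows c e f a b d t i ≠ 0 := fun t i h0 =>
    hc (h.swap01.swap12.swap23.isCritical_of_heronRows_eq_zero h0).swap23.swap12.swap01
  have hpair : ∀ t, ∃ i j, i ≠ j ∧
      IsMultiple (heronRows a b c d e f t i) (heronRows a b c d e f t j) := by
    intro t
    fin_cases t
    · exact h.exists_isMultiple_heron hne
    · exact h.swap23.exists_isMultiple_heron ne1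
    · exact h.swap12.swap23.exists_isMultiple_heron ne2
    · exact h.swap01.swap12.swap23.exists_isMultiple_heron ne3
  have hcompl := h.isMultiple_complement hne hpair
  have F0 : IsFlat a b c := isFlat_of_isMultiple_heron (hpair 0) (hcompl 0) (hne 0)
  have F1 : IsFlat a d e := isFlat_of_isMultiple_heron (hpair 1) (hcompl 1) (hne 1)
  have F2 : IsFlat b d f := isFlat_of_isMultiple_heron (hpair 2) (hcompl 2) (hne 2)
  have F3 : IsFlat c e f := isFlat_of_isMultiple_heron (hpair 3) (hcompl 3) (hne 3)
  by_cases ha : a = 0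
  · exact h.false_of_eq_zero ha hne F2 F3
  by_cases hb : b = 0
  · exact h.swap12.false_of_eq_zero hb
      (fun t i h0 => hc (h.swap12.isCritical_of_heronRows_eq_zero h0).swap12) F1 F3.swap_right
  by_cases hc0 : c = 0
  · exact h.swap01.swap12.false_of_eq_zero hc0
      (fun t i h0 => hc (h.swap01.swap12.isCritical_of_heronRows_eq_zero h0).swap12.swap01)
      F1.swap_right F2.swap_right
  by_cases hd : d = 0
  · exact h.swap12.swap23.swap12.false_of_eq_zero hd
      (fun t i h0 => hc
        (h.swap12.swap23.swap12.isCritical_of_heronRows_eq_zero h0).swap12.swap23.swap12)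
      F0.swap F3.swap_right.swap.swap_right
  by_cases he : e = 0
  · exact h.swap01.swap12.swap23.swap12.false_of_eq_zero he
      (fun t i h0 => hc
        (h.swap01.swap12.swap23.swap12.isCritical_of_heronRows_eq_zero
          h0).swap12.swap23.swap12.swap01)
      F0.swap_right.swap F2.swap_right.swap.swap_right
  -- With `a, b, c, d, e` nonzero, two flat triangles on the edge `a` make `b, c, d, e` multiples of
  -- `a`, so `a` and `f` span everything; `f = 0` needs no separate case.
  rcases F0 with h0 | h0 | h0 | ⟨hab, hac⟩
  · exact ha h0
  · exact hb h0
  · exact hc0 h0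
  rcases F1 with h0 | h0 | h0 | ⟨had, hae⟩
  · exact ha h0
  · exact hd h0
  · exact he h0
  have L := left_mem_span_pair a f
  exact h.spans a f L (hab.mem L) (hac.mem L) (had.mem L) (hae.mem L) (right_mem_span_pair a f)

/-! ### From linear forms back to subspaces -/

section Subspace

variable {n : ℕ}

/-- A vector of `ℂⁿ` as a linear form. -/
noncomputable def linearFormOf (n : ℕ) : (Fin n → ℂ) →ₗ[ℂ] MvPolynomial (Fin n) ℂ :=
  Fintype.linearCombination ℂ (X : Fin n → MvPolynomial (Fin n) ℂ)

lemma linearFormOf_isHomogeneous (v : Fin n → ℂ) : (linearFormOf n v).IsHomogeneous 1 := by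
  rw [linearFormOf, Fintype.linearCombination_apply]
  refine IsHomogeneous.sum _ _ _ fun i _ => ?_
  rw [smul_eq_C_mul]
  exact isHomogeneous_C_mul (isHomogeneous_X ℂ i) _

lemma eval_linearFormOf (t v : Fin n → ℂ) : eval t (linearFormOf n v) = ∑ i, v i * t i := by
  simp [linearFormOf, Fintype.linearCombination_apply, smul_eq_C_mul]

lemma linearFormOf_injective : Function.Injective (linearFormOf n) := by
  intro v w h
  ext i
  have := congrArg (eval (Pi.single i 1)) h
  simpa [eval_linearFormOf, Pi.single_apply] using this

/-- Linear forms with independent columns of coefficients are not in the span of two forms. -/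
lemma not_forall_mem_span_pair {ι : Type*} (hn : 3 ≤ n) {β : Fin n → ι → ℂ}
    (hβ : LinearIndependent ℂ β) (u v : MvPolynomial (Fin n) ℂ) :
    ¬ ∀ i, linearFormOf n (fun j => β j i) ∈ Submodule.span ℂ {u, v} := by
  classical
  intro h
  set N := (Submodule.span ℂ {u, v}).comap (linearFormOf n) with hN
  have hlt : N < ⊤ := by
    rw [lt_top_iff_ne_top]
    intro htop
    have h1 : LinearMap.range (linearFormOf n) ≤ Submodule.span ℂ {u, v} := by
      rintro _ ⟨w, rfl⟩
      have : w ∈ N := htop ▸ Submodule.mem_top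
      exact this
    have : Module.Finite ℂ (Submodule.span ℂ {u, v}) :=
      Module.Finite.span_of_finite ℂ (Set.toFinite _)
    have h2 := Submodule.finrank_mono h1
    rw [LinearMap.finrank_range_of_inj linearFormOf_injective, Module.finrank_fin_fun] at h2
    have h3 := finrank_span_finset_le_card (R := ℂ) ({u, v} : Finset (MvPolynomial (Fin n) ℂ))
    rw [Finset.coe_pair] at h3
    have := h3.trans Finset.card_le_two
    rw [Set.finrank] at this
    omega
  -- A nonzero functional that kills all columns is a linear relation between the rows `β j`.
  obtain ⟨φ, hφ0, hφ⟩ := Submodule.exists_le_ker_of_lt_top N hlt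
  have hφv : ∀ w : Fin n → ℂ, φ w = ∑ j, φ (Pi.single j 1) * w j := by
    intro w
    conv_lhs => rw [pi_eq_sum_univ' w]
    rw [map_sum]
    refine Finset.sum_congr rfl fun j _ => ?_
    rw [map_smul, smul_eq_mul, mul_comm]
  have h0 : ∑ j, φ (Pi.single j 1) • β j = 0 := by
    ext i
    have h1 : φ (fun j => β j i) = 0 := hφ (h i)
    rw [hφv] at h1
    simpa [Finset.sum_apply] using h1
  have h1 := Fintype.linearIndependent_iff.mp hβ _ h0
  refine hφ0 (LinearMap.ext fun w => ?_)
  rw [hφv]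
  simp [h1]

/-- The coordinates of a general point of `W` in a basis are linear forms. The determinant vanishes
at every value of the parameters, hence as a polynomial, and `IsFrame.isCritical` is specialized to
the given point. -/
lemma isCritical_of_mem_of_subset {W : Submodule ℂ (Edge 4 → ℂ)} (hW : 3 ≤ Module.finrank ℂ W)
    (h : (W : Set (Edge 4 → ℂ)) ⊆ measurementVariety 2 4) {l : Edge 4 → ℂ} (hl : l ∈ W) :
    IsCritical (l e01) (l e02) (l e12) (l e03) (l e13) (l e23) := by
  set n := Module.finrank ℂ W with hn
  let B := Module.finBasis ℂ W
  let p : Edge 4 → MvPolynomial (Fin n) ℂ := fun i => linearFormOf n fun j => (B j : Edge 4 → ℂ) i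
  have hp : ∀ t i, eval t (p i) = ((∑ j, t j • B j : W) : Edge 4 → ℂ) i := by
    intro t i
    simp only [p, eval_linearFormOf, AddSubmonoidClass.coe_finsetSum, Finset.sum_apply,
      SetLike.val_smul, Pi.smul_apply, smul_eq_mul, mul_comm]
  have hli : LinearIndependent ℂ fun j => (B j : Edge 4 → ℂ) :=
    B.linearIndependent.map' W.subtype W.ker_subtype
  have hF : IsFrame (p e01) (p e02) (p e12) (p e03) (p e13) (p e23) := by
    refine ⟨linearFormOf_isHomogeneous _, linearFormOf_isHomogeneous _,
      linearFormOf_isHomogeneous _, linearFormOf_isHomogeneous _, linearFormOf_isHomogeneous _,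
      linearFormOf_isHomogeneous _, ?_, ?_⟩
    · refine MvPolynomial.funext fun t => ?_
      have h1 := h (∑ j, t j • B j : W).2
      rw [measurementVariety_two_four, Set.mem_ofPred_eq, eval_cayleyMengerPoly] at h1
      rw [map_cayleyMenger, map_zero]
      simpa only [hp] using h1
    · intro u v h1 h2 h3 h4 h5 h6
      exact not_forall_mem_span_pair hW hli u v (forall_edge.mpr ⟨h1, h2, h3, h4, h5, h6⟩)
  have hcr := hF.isCritical.map (eval (B.repr ⟨l, hl⟩))
  have hs : (∑ j, (B.repr ⟨l, hl⟩) j • B j : W) = ⟨l, hl⟩ := B.sum_repr _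
  simp only [hp] at hcr
  rw [hs] at hcr
  exact hcr

/-- A vector space over an infinite field is not a finite union of proper subspaces. -/
lemma exists_le_degenerateSubspace {W : Submodule ℂ (Edge 4 → ℂ)} (hW : 3 ≤ Module.finrank ℂ W)
    (h : (W : Set (Edge 4 → ℂ)) ⊆ measurementVariety 2 4) :
    ∃ k, W ≤ degenerateSubspace k := by
  obtain ⟨k, hk⟩ := Subspace.exists_eq_top_of_iUnion_eq_univ
    (p := fun k => (degenerateSubspace k).comap W.subtype) (by
      rw [Set.eq_univ_iff_forall]
      intro l
      obtain ⟨k, hk⟩ := isCritical_iff_exists_mem.mp (isCritical_of_mem_of_subset hW h l.2)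
      exact Set.mem_iUnion.mpr ⟨k, hk⟩)
  refine ⟨k, fun l hl => ?_⟩
  have : (⟨l, hl⟩ : W) ∈ (degenerateSubspace k).comap W.subtype := hk ▸ Submodule.mem_top
  exact this

lemma degenerateSubspace_subset (k : SubspaceIndex) :
    (degenerateSubspace k : Set (Edge 4 → ℂ)) ⊆ measurementVariety 2 4 := by
  intro l hl
  rw [measurementVariety_two_four, Set.mem_ofPred_eq, eval_cayleyMengerPoly]
  exact (isCritical_of_mem_degenerateSubspace hl).cayleyMenger_eq_zero

end Subspace

end Classification

theorem mainTheorem11 :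
    ∃ S : Finset (Submodule ℂ (Edge 4 → ℂ)),
      S.card = 60 ∧
      (∀ W ∈ S, Module.finrank ℂ W = 3) ∧
      singularLocus (measurementVariety 2 4) = ⋃ W ∈ S, (W : Set (Edge 4 → ℂ)) ∧
      (∀ W : Submodule ℂ (Edge 4 → ℂ), Module.finrank ℂ W = 3 →
        ((W : Set (Edge 4 → ℂ)) ⊆ measurementVariety 2 4 ↔ W ∈ S)) ∧
      (∀ W : Submodule ℂ (Edge 4 → ℂ), 4 ≤ Module.finrank ℂ W →
        ¬ ((W : Set (Edge 4 → ℂ)) ⊆ measurementVariety 2 4)) := by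
  refine ⟨Finset.univ.map ⟨degenerateSubspace, degenerateSubspace_injective⟩, ?_, ?_, ?_, ?_, ?_⟩
  · rw [Finset.card_map]
    rfl
  · intro W hW
    obtain ⟨k, -, rfl⟩ := Finset.mem_map.mp hW
    exact finrank_degenerateSubspace k
  · rw [singularLocus_measurementVariety_two_four]
    ext l
    simp only [Set.mem_ofPred_eq, isCritical_iff_exists_mem, Finset.mem_map, Finset.mem_univ,
      true_and, Function.Embedding.coeFn_mk, Set.iUnion_exists, Set.iUnion_iUnion_eq',
      Set.mem_iUnion, SetLike.mem_coe]
  · intro W hW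
    constructor
    · intro h
      obtain ⟨k, hk⟩ := exists_le_degenerateSubspace hW.ge h
      have := Submodule.eq_of_le_of_finrank_eq hk (by rw [hW, finrank_degenerateSubspace])
      exact Finset.mem_map.mpr ⟨k, Finset.mem_univ k, this.symm⟩
    · intro h
      obtain ⟨k, -, rfl⟩ := Finset.mem_map.mp h
      exact degenerateSubspace_subset k
  · intro W hW h
    obtain ⟨k, hk⟩ := exists_le_degenerateSubspace (by omega) h
    have := Submodule.finrank_mono hk
    rw [finrank_degenerateSubspace] at this
    omega
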